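/- **Corollary 4.3.** Let $\mathcal X=\mathbb R^d$ with the Euclidean norm, $I=[0,T]$, $1<p<\infty$ and $\frac1p<\alpha<1$. Let $\nu$ be a Borel probability measure on $\mathcal X$ that is absolutely continuous with respect to Lebesgue measure and has finite $p$-th moment. Let $(\Omega,\mathcal F,\mathbb P)$ be a probability space. *Notation.* $P_p(\mathcal X)$ is the set of Borel probability measures on $\mathcal X$ with finite $p$-th moment, with the $p$-Wasserstein distance $W_p$. $P_{p,\Omega}(\mathcal X)$ is the set of random probability measures $\mu=(\mu^\omega)_{\omega\in\Omega}$ on $\mathcal X$ with $\mathbb E\int|x|^p\,d\mu(x)<\infty$. For $\lambda\in P_p(\mathcal X)$, let $T_\nu^\lambda$ be the optimal transport map from $\nu$ to $\lambda$ for the cost $|x-y|^p$ (that is, $(\mathrm{id},T_\nu^\lambda)_\#\nu$ is an optimal coupling of $\nu$ and $\lambda$), and put $$W_{p,\nu}(\lambda_0,\lambda_1)=\Big(\int|T_\nu^{\lambda_1}-T_\nu^{\lambda_0}|^p\,d\nu\Big)^{1/p}.$$ For $\mu,\mu'\in P_{p,\Omega}(\mathcal X)$ put $$\mathbb W_p(\mu,\mu')=\Big(\inf_{\Upsilon}\mathbb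 E\int|x-y|^p\,d\Upsilon(x,y)\Big)^{1/p},\qquad \mathbb W_{p,\nu}(\mu,\mu')=\big(\mathbb E[W_{p,\nu}(\mu,\mu')^p]\big)^{1/p},$$ the infimum being over the random couplings, i.e. the random probability measures $\Upsilon$ on $\mathcal X^2$ such that $\Upsilon^\omega$ is a coupling of $\mu^\omega$ and $\mu'^\omega$ a.s. For a metric space $(M,\rho)$, $W^{\alpha,p}(I;M)$ is the set of continuous curves $X:I\to M$ with $$|X|_{W^{\alpha,p}}^p=\iint_{I^2}\frac{\rho(X_u,X_v)^p}{|v-u|^{1+\alpha p}}\,du\,dv<\infty .$$ For curves of random measures, $\|\cdot\|_{W^{\alpha,p}}$ and $\|\cdot\|_{W^{\alpha,p},\nu}$ denote this quantity for $\rho=\mathbb W_p$ and $\rho=\mathbb W_{p,\nu}$. $C(I;\mathcal X)$ carries the uniform topology and its Borel $\sigma$-algebra, and $e_t(\gamma)=\gamma_t$. *Statement.* Let $(\mu_t)_{t\in I}$ be a process of random probability measures on $\Omega$ that belongs to $W^{\alpha,p}(I;(P_{p,\Omega}(\mathcal X),\mathbb W_{p,\nu}))$. Then, for every $t\in I$,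 for $\mathbb P$-a.e. $\omega$ the optimal transport map $T_t^\omega$ from $\nu$ to $\mu_t^\omega$ exists and is unique $\nu$-a.e. Moreover there is a random probability measure $\pi$ on $C(I;\mathcal X)$ such that for every finite sequence $t_1,\dots,t_j\in I$ $$(e_{t_1},\dots,e_{t_j})_\#\pi^\omega=(T^\omega_{t_1},\dots,T^\omega_{t_j})_\#\nu\qquad\mathbb P\text{-a.s.},$$ and $\pi$ satisfies: (i) for $\mathbb P$-a.e. $\omega$, $\pi^\omega$ is concentrated on $W^{\alpha,p}(I;\mathcal X)$, and $t\mapsto(e_t)_\#\pi^\omega$ belongs to $W^{\alpha,p}(I;(P_p(\mathcal X),W_p))$; (ii) for every $t\in I$, $(e_t)_\#\pi^\omega=\mu_t^\omega$ $\mathbb P$-a.s. (that is, $\pi$ is a random lift of $(\mu_t)$); (iii) for all $s,t\in I$, $$\mathbb W_p^p(\mu_s,\mu_t)\le\mathbb E\Big[\int|\gamma_t-\gamma_s|^p\,d\pi(\gamma)\Big]=\mathbb W_{p,\nu}^p(\mu_s,\mu_t),$$ and $$\|\mu\|_{W^{\alpha,p}}^p\le\mathbb E\Big[\int|\gamma|_{W^{\alpha,p}}^p\,d\pi(\gamma)\Big]=\|\mu\|_{W^{\alpha,p},\nu}^p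 .$$ -/

import Mathlib

open MeasureTheory ProbabilityTheory Filter Topology
open scoped ENNReal

namespace RandomLift

/-- The Euclidean space `ℝ^d`, with its Euclidean norm. -/
abbrev E (d : ℕ) : Type := EuclideanSpace ℝ (Fin d)

/-- The time interval `I = [0, T]`. -/
abbrev I (T : ℝ) : Type := Set.Icc (0 : ℝ) T

/-- Lebesgue measure on the time interval `[0, T]`. -/
noncomputable def leb (T : ℝ) : Measure (I T) := Measure.comap Subtype.val volume

/-- The path space `C([0, T]; ℝ^d)`, with the topology of uniform convergence. -/
abbrev Paths (T : ℝ) (d : ℕ) : Type := C(I T, E d)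

/-- The path space carries the Borel `σ`-algebra of uniform convergence. -/
instance instMeasurableSpacePaths (T : ℝ) (d : ℕ) : MeasurableSpace (Paths T d) := borel _

instance instBorelSpacePaths (T : ℝ) (d : ℕ) : BorelSpace (Paths T d) := ⟨rfl⟩

section Sobolev

variable {T : ℝ}

/-- The `p`-th power of the fractional Sobolev `W^{α,p}` seminorm of a curve `X` on `[0, T]` in a
metric space, as a function of the distances `D u v = d (X u, X v)` along the curve:
`∬_{[0,T]²} d (X u, X v)^p / |v - u|^(1 + α p) du dv`. -/
noncomputable def sobolevEnergy (α p : ℝ) (D : I T → I T → ℝ≥0∞) : ℝ≥0∞ :=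
  ∫⁻ u, ∫⁻ v, D u v ^ p / ENNReal.ofReal (|(v : ℝ) - (u : ℝ)| ^ (1 + α * p)) ∂(leb T) ∂(leb T)

/-- A curve on `[0, T]` in a metric space, with distances `D u v = d (X u, X v)` along the curve,
belongs to `W^{α,p}` for `α > 1/p`: it is continuous, and its `W^{α,p}` seminorm is finite. -/
def IsSobolevCurve (α p : ℝ) (D : I T → I T → ℝ≥0∞) : Prop :=
  (∀ t, Tendsto (fun s => D s t) (𝓝 t) (𝓝 0)) ∧ sobolevEnergy α p D < ∞

/-- The `p`-th power of the `W^{α,p}` seminorm of a path in `ℝ^d`. -/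
noncomputable def pathEnergy {d : ℕ} (α p : ℝ) (γ : Paths T d) : ℝ≥0∞ :=
  sobolevEnergy α p (fun s t => edist (γ s) (γ t))

end Sobolev

section Transport

variable {d : ℕ}

/-- `μ` belongs to `P_p(ℝ^d)`: it is a probability measure with finite `p`-th moment. -/
def MemPp (p : ℝ) (μ : Measure (E d)) : Prop :=
  IsProbabilityMeasure μ ∧ ∫⁻ x, ‖x‖ₑ ^ p ∂μ < ∞

/-- `Υ` is a coupling of `μ` and `ν`. -/
def IsCoupling (Υ : Measure (E d × E d)) (μ ν : Measure (E d)) : Prop :=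
  Υ.map Prod.fst = μ ∧ Υ.map Prod.snd = ν

/-- The transport cost `∫ |x - y|^p dΥ(x, y)` of a coupling. -/
noncomputable def cost (p : ℝ) (Υ : Measure (E d × E d)) : ℝ≥0∞ :=
  ∫⁻ z, edist z.1 z.2 ^ p ∂Υ

/-- `Υ` is an optimal coupling of `μ` and `ν` for the cost `|x - y|^p`. -/
def IsOptimalCoupling (p : ℝ) (Υ : Measure (E d × E d)) (μ ν : Measure (E d)) : Prop :=
  IsCoupling Υ μ ν ∧ ∀ Υ', IsCoupling Υ' μ ν → cost p Υ ≤ cost p Υ'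

/-- The `p`-Wasserstein distance. -/
noncomputable def Wp (p : ℝ) (μ ν : Measure (E d)) : ℝ≥0∞ :=
  (⨅ (Υ : Measure (E d × E d)) (_ : IsCoupling Υ μ ν), cost p Υ) ^ (1 / p)

/-- `S` is an optimal transport map from `ν` to `μ` for the cost `|x - y|^p`: the coupling
`(id, S)_# ν` of `ν` and `μ` is optimal. -/
def IsOptimalMap (p : ℝ) (ν μ : Measure (E d)) (S : E d → E d) : Prop :=
  Measurable S ∧ IsOptimalCoupling p (ν.map (fun y => (y, S y))) ν μ

open Classical in
/-- The optimal transport map from `ν` to `μ` for the cost `|x - y|^p` (a choice of one, or the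
identity if there is none). -/
noncomputable def optMap (p : ℝ) (ν μ : Measure (E d)) : E d → E d :=
  if h : ∃ S, IsOptimalMap p ν μ S then h.choose else id

/-- The `ν`-based Wasserstein distance between `μ₀` and `μ₁`: the `L^p(ν)` distance between the
optimal maps from `ν` to `μ₀` and from `ν` to `μ₁`. -/
noncomputable def WpBased (p : ℝ) (ν μ₀ μ₁ : Measure (E d)) : ℝ≥0∞ :=
  (∫⁻ y, edist (optMap p ν μ₁ y) (optMap p ν μ₀ y) ^ p ∂ν) ^ (1 / p)

end Transport

section Random

variable {d : ℕ} {Ω : Type*} [MeasurableSpace Ω]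

/-- `μ` is a random probability measure: `ω ↦ μ^ω(A)` is measurable for every measurable `A` (this
is what a kernel is), and `μ^ω` is a probability measure for almost every `ω`. -/
def IsRandomProb {X : Type*} [MeasurableSpace X] (P : Measure Ω) (μ : Kernel Ω X) : Prop :=
  ∀ᵐ ω ∂P, IsProbabilityMeasure (μ ω)

/-- `μ` belongs to `P_{p,Ω}(ℝ^d)`: it is a random probability measure with
`𝔼 ∫ |x|^p dμ(x) < ∞`. -/
def MemPpΩ (p : ℝ) (P : Measure Ω) (μ : Kernel Ω (E d)) : Prop :=
  IsRandomProb P μ ∧ ∫⁻ ω, ∫⁻ x, ‖x‖ₑ ^ p ∂(μ ω) ∂P < ∞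

/-- The distance `𝕎_p` on random probability measures: the `p`-th root of the infimum of
`𝔼 ∫ |x - y|^p dΥ(x, y)` over the random couplings `Υ`. -/
noncomputable def WWp (p : ℝ) (P : Measure Ω) (μ ν : Kernel Ω (E d)) : ℝ≥0∞ :=
  (⨅ (Υ : Kernel Ω (E d × E d)) (_ : ∀ᵐ ω ∂P, IsCoupling (Υ ω) (μ ω) (ν ω)),
    ∫⁻ ω, cost p (Υ ω) ∂P) ^ (1 / p)

/-- The `ν`-based distance `𝕎_{p,ν}` on random probability measures:
`𝕎_{p,ν}(μ₀, μ₁) = (𝔼 [W_{p,ν}(μ₀, μ₁)^p])^(1/p)`. -/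
noncomputable def WWpBased (p : ℝ) (P : Measure Ω) (ν : Measure (E d))
    (μ₀ μ₁ : Kernel Ω (E d)) : ℝ≥0∞ :=
  (∫⁻ ω, WpBased p ν (μ₀ ω) (μ₁ ω) ^ p ∂P) ^ (1 / p)

end Random

end RandomLift

open RandomLift

/-! Read the optimal maps as a stochastic process `X_t(ω, y) = T_t^ω(y)` on `Ω × ℝ^d` under `P ⊗ ν`.
The `p`-th power of `WWpBased` is then exactly the expectation of `|X_s - X_t|^p`, so the hypothesis
says that `X` is continuous in `L^p` with finite expected `W^{α,p}` energy. Since `αp > 1`, a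
Kolmogorov-type criterion (`exists_continuous_modification`) gives a modification `Y` with
continuous paths, and `π^ω` is the law of `Y(ω, ·)` under `ν`. The equalities become Tonelli and
change of variables; the inequalities hold because the joint law of `(γ_s, γ_t)` under `π` competes
in the infimum defining `WWp`.

Two inputs carry the weight. First, optimal maps must exist, be unique and be jointly measurable.
Duality is avoided: exchanging the targets of two independent samples shows that the support of an
optimal coupling is cost-monotone (`IsOptimalCoupling.ae_exchange`), and a first-order argument
shows that such a set has at most one point over almost every `x` (`CostMonotone.ae_subsingleton`).
Averaging two optimal couplings gives uniqueness; uniqueness and weak compactness make the optimal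
coupling measurable in `ω` (`exists_kernel_isOptimalCoupling`), and the map is the barycenter of its
conditional kernel.

Second, the fractional Sobolev embedding (`exists_continuous_version`): averages over balls of
halving radius converge geometrically, and their limit is a Hölder version of the curve. -/

open scoped BoundedContinuousFunction NNReal

namespace RandomLift

/-! ### Cost-monotone sets are almost everywhere graphs -/

section TwoMonotone

variable {F : Type*} [NormedAddCommGroup F] [InnerProductSpace ℝ F]

/-- A set contained in a narrow cone around a hyperplane based at each of its points is negligible:
it is disjoint from its translates in a transversal direction. -/
theorem volume_eq_zero_of_abs_le [FiniteDimensional ℝ F] [MeasurableSpace F] [BorelSpace F]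
    {A : Set F} (L : F →L[ℝ] ℝ) (e : F)
    {ε : ℝ} (hε : ε * ‖e‖ < |L e|) (hA : ∀ x ∈ A, ∀ y ∈ A, |L (x - y)| ≤ ε * ‖x - y‖) :
    volume A = 0 := by
  -- `A` need not be measurable; the cone condition is closed, so it passes to the closure, which
  -- is.
  have hcl : ∀ x ∈ closure A, ∀ y ∈ closure A, |L (x - y)| ≤ ε * ‖x - y‖ := by
    intro x hx y hy
    have hxy : (x, y) ∈ closure (A ×ˢ A) := by
      rw [closure_prod_eq]; exact ⟨hx, hy⟩
    have hclosed : IsClosed {z : F × F | |L (z.1 - z.2)| ≤ ε * ‖z.1 - z.2‖} :=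
      isClosed_le (by fun_prop) (by fun_prop)
    exact closure_minimal (fun z hz => hA z.1 hz.1 z.2 hz.2) hclosed hxy
  refine measure_mono_null subset_closure ?_
  -- If the translates by two vectors `e/(n+1)` met, a nonzero multiple of `e` would be a difference
  -- of points of the closure, against `ε‖e‖ < |L e|`.
  refine Measure.addHaar_eq_zero_of_disjoint_translates volume
    (fun n : ℕ => (1 / ((n : ℝ) + 1)) • e) ?_ ?_ isClosed_closure.measurableSet
  · refine (Metric.isBounded_closedBall (x := (0 : F)) (r := ‖e‖)).subset ?_
    rintro _ ⟨n, rfl⟩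
    simp only [mem_closedBall_zero_iff, norm_smul]
    have h1 : ‖(1 / ((n : ℝ) + 1))‖ ≤ 1 := by
      rw [Real.norm_of_nonneg (by positivity), div_le_one (by positivity)]
      linarith [n.cast_nonneg (α := ℝ)]
    nlinarith [norm_nonneg e]
  · intro n m hnm
    rw [Function.onFun, Set.disjoint_left]
    rintro z ⟨_, rfl, x, hx, hxz⟩ ⟨_, rfl, y, hy, hyz⟩
    dsimp only at hxz hyz
    set s : ℝ := 1 / ((m : ℝ) + 1) - 1 / ((n : ℝ) + 1) with hs
    have hxy : x - y = s • e := by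
      rw [hs, sub_smul, sub_eq_sub_iff_add_eq_add, add_comm, hxz, ← hyz]
    have hs0 : s ≠ 0 := by
      intro h0
      rw [hs, sub_eq_zero, one_div, one_div, inv_inj] at h0
      exact hnm (by exact_mod_cast (add_right_cancel h0).symm)
    have := hcl x hx y hy
    rw [hxy, map_smul, norm_smul, smul_eq_mul, abs_mul, Real.norm_eq_abs] at this
    have h2 : |s| * (ε * ‖e‖) < |s| * |L e| := mul_lt_mul_of_pos_left hε (abs_pos.mpr hs0)
    nlinarith

/-- The gradient of `‖x‖ ^ p` determines `x`. -/
theorem fderiv_norm_rpow_injective {p : ℝ} (hp : 1 < p) :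
    Function.Injective (fderiv ℝ (fun x : F => ‖x‖ ^ p)) := by
  intro x y hxy
  have hnorm : ‖x‖ = ‖y‖ := by
    have h := congrArg norm hxy
    rw [norm_fderiv_norm_id_rpow x hp, norm_fderiv_norm_id_rpow y hp] at h
    exact (Real.rpow_left_inj (norm_nonneg _) (norm_nonneg _) (by linarith)).1
      (mul_left_cancel₀ (by linarith) h)
  by_cases hx : x = 0
  · have : ‖y‖ = 0 := by rw [← hnorm, hx, norm_zero]
    rw [hx, norm_eq_zero.1 this]
  · rw [fderiv_norm_rpow x hp, fderiv_norm_rpow y hp, ← hnorm] at hxy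
    have h0 : p * ‖x‖ ^ (p - 2) ≠ 0 :=
      mul_ne_zero (by linarith) (Real.rpow_pos_of_pos (norm_pos_iff.2 hx) _).ne'
    have h1 := smul_right_injective _ h0 hxy
    refine ext_inner_right ℝ fun v => ?_
    simpa using congrArg (fun l => l v) h1

/-- Mean value theorem for `z ↦ ‖z - y₂‖^p - ‖z - y₁‖^p`, which by `h` does not increase from `x` to
`x'`. It turns the exchange inequality into a first-order condition. -/
theorem exists_fderiv_sub_le_zero {p : ℝ} (hp : 1 < p) {x x' y₁ y₂ : F}
    (h : ‖x - y₁‖ ^ p + ‖x' - y₂‖ ^ p ≤ ‖x - y₂‖ ^ p + ‖x' - y₁‖ ^ p) :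
    ∃ z ∈ segment ℝ x x', (fderiv ℝ (fun x : F => ‖x‖ ^ p) (z - y₂)
      - fderiv ℝ (fun x : F => ‖x‖ ^ p) (z - y₁)) (x' - x) ≤ 0 := by
  set D := fderiv ℝ (fun x : F => ‖x‖ ^ p) with hD
  have hd : ∀ z : F, HasFDerivAt (fun x : F => ‖x‖ ^ p) (D z) z := fun z =>
    (differentiable_norm_rpow hp z).hasFDerivAt
  have hline : ∀ (y : F) (t : ℝ), HasDerivAt (fun t : ℝ => ‖x + t • (x' - x) - y‖ ^ p)
      (D (x + t • (x' - x) - y) (x' - x)) t := by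
    intro y t
    have h1 : HasDerivAt (fun t : ℝ => x + t • (x' - x) - y) (x' - x) t := by
      simpa using (((hasDerivAt_id t).smul_const (x' - x)).const_add x).sub_const y
    exact (hd _).comp_hasDerivAt t h1
  obtain ⟨t, ht, hslope⟩ := exists_hasDerivAt_eq_slope
    (fun t : ℝ => ‖x + t • (x' - x) - y₂‖ ^ p - ‖x + t • (x' - x) - y₁‖ ^ p) _ zero_lt_one
    (fun t _ => ((hline y₂ t).sub (hline y₁ t)).continuousAt.continuousWithinAt)
    (fun t _ => (hline y₂ t).sub (hline y₁ t))
  refine ⟨x + t • (x' - x), ?_, ?_⟩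
  · rw [segment_eq_image']
    exact ⟨t, ⟨ht.1.le, ht.2.le⟩, rfl⟩
  · rw [sub_apply, hslope]
    simp only [one_smul, zero_smul, add_zero, add_sub_cancel, sub_zero, div_one]
    linarith

/-- A set `G ⊆ F × F` is monotone for the cost `‖x - y‖ ^ p` if exchanging the second coordinates
of two of its points does not decrease the cost. -/
def CostMonotone (p : ℝ) (G : Set (F × F)) : Prop :=
  ∀ z ∈ G, ∀ w ∈ G, ‖z.1 - z.2‖ ^ p + ‖w.1 - w.2‖ ^ p ≤ ‖z.1 - w.2‖ ^ p + ‖w.1 - z.2‖ ^ p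

/-- The sections of a cost-monotone set are almost everywhere subsingletons. -/
theorem CostMonotone.ae_subsingleton [FiniteDimensional ℝ F] [MeasurableSpace F] [BorelSpace F]
    {p : ℝ} (hp : 1 < p) {G : Set (F × F)} (hG : CostMonotone p G) :
    ∀ᵐ x, {y | (x, y) ∈ G}.Subsingleton := by
  set D := fderiv ℝ (fun x : F => ‖x‖ ^ p) with hD
  have hDc : Continuous D := (contDiff_norm_rpow hp).continuous_fderiv one_ne_zero
  -- The triples witnessing a section with two points. The projection of `N` is shown to be null
  -- near each triple; the Lindelöf property then makes it null.
  set N : Set (F × F × F) := {q | (q.1, q.2.1) ∈ G ∧ (q.1, q.2.2) ∈ G ∧ q.2.1 ≠ q.2.2} with hN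
  have hloc : ∀ q ∈ N, ∃ U ∈ 𝓝 q, volume (Prod.fst '' (U ∩ N)) = 0 := by
    rintro ⟨x₀, a₁, a₂⟩ ⟨-, -, hne⟩
    dsimp only at hne
    set L : F →L[ℝ] ℝ := D (x₀ - a₁) - D (x₀ - a₂) with hL
    have hL0 : L ≠ 0 := by
      intro h0
      exact hne (sub_right_injective (fderiv_norm_rpow_injective hp (sub_eq_zero.1 h0)))
    obtain ⟨e, he⟩ : ∃ e, L e ≠ 0 := by
      by_contra! hcon
      exact hL0 (ContinuousLinearMap.ext hcon)
    set ε : ℝ := |L e| / (‖e‖ + 1) with hε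
    have hεpos : 0 < ε := div_pos (abs_pos.2 he) (by positivity)
    have hεe : ε * ‖e‖ < |L e| := by
      rw [hε, div_mul_eq_mul_div, div_lt_iff₀ (by positivity)]
      nlinarith [abs_pos.2 he]
    have hc : ContinuousAt (fun q : F × F × F => D (q.1 - q.2.1) - D (q.1 - q.2.2))
        (x₀, a₁, a₂) := by fun_prop
    obtain ⟨r, hr, hball⟩ := Metric.continuousAt_iff.1 hc ε hεpos
    refine ⟨Metric.ball (x₀, a₁, a₂) r, Metric.ball_mem_nhds _ hr, ?_⟩
    have hmem : ∀ z w₁ w₂, dist z x₀ < r → dist w₁ a₁ < r → dist w₂ a₂ < r → ∀ v : F,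
        |(D (z - w₁) - D (z - w₂)) v - L v| ≤ ε * ‖v‖ := by
      intro z w₁ w₂ hz hw₁ hw₂ v
      have h1 := hball (x := (z, w₁, w₂)) (by
        simp only [Prod.dist_eq, max_lt_iff]; exact ⟨hz, hw₁, hw₂⟩)
      rw [dist_eq_norm] at h1
      exact ((D (z - w₁) - D (z - w₂) - L).le_opNorm v).trans
        (mul_le_mul_of_nonneg_right h1.le (norm_nonneg v))
    refine volume_eq_zero_of_abs_le L e hεe ?_
    have key : ∀ x ∈ Prod.fst '' (Metric.ball (x₀, a₁, a₂) r ∩ N),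
        ∀ x' ∈ Prod.fst '' (Metric.ball (x₀, a₁, a₂) r ∩ N), L (x' - x) ≤ ε * ‖x - x'‖ := by
      rintro _ ⟨⟨x, y₁, y₂⟩, ⟨hb, h1, h2, -⟩, rfl⟩ _ ⟨⟨x', y₁', y₂'⟩, ⟨hb', h1', h2', -⟩, rfl⟩
      simp only [Metric.mem_ball, Prod.dist_eq, max_lt_iff] at hb hb'
      dsimp only at *
      -- Pairing the second target over `x` with the first over `x'` makes the gradient difference
      -- close to `L`, so `L` is nearly nonpositive on `x' - x`; swapping `x` and `x'` gives the
      -- cone condition.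
      obtain ⟨z, hz, hzle⟩ := exists_fderiv_sub_le_zero hp (hG _ h2 _ h1')
      have hzb : z ∈ Metric.ball x₀ r := (convex_ball x₀ r).segment_subset
        (Metric.mem_ball.2 hb.1) (Metric.mem_ball.2 hb'.1) hz
      have h3 := hmem z y₁' y₂ (Metric.mem_ball.1 hzb) hb'.2.1 hb.2.2 (x' - x)
      rw [abs_le] at h3
      rw [norm_sub_rev x' x] at h3
      linarith
    intro x hx x' hx'
    have h1 := key x hx x' hx'
    have h2 := key x' hx' x hx
    rw [← neg_sub x x', map_neg] at h1
    rw [norm_sub_rev x' x] at h2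
    exact abs_le.2 ⟨by linarith, h2⟩
  choose! U hU hU0 using hloc
  obtain ⟨S, hSN, hSc, hScov⟩ := TopologicalSpace.countable_cover_nhdsWithin
    (f := U) (s := N) (fun q hq => mem_nhdsWithin_of_mem_nhds (hU q hq))
  have hnull : volume (Prod.fst '' N) = 0 := by
    refine measure_mono_null ?_ ((measure_biUnion_null_iff hSc).2 fun q hq => hU0 q (hSN hq))
    rintro _ ⟨q, hq, rfl⟩
    obtain ⟨s, hs, hqs⟩ := Set.mem_iUnion₂.1 (hScov hq)
    exact Set.mem_biUnion hs ⟨q, ⟨hqs, hq⟩, rfl⟩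
  rw [ae_iff]
  refine measure_mono_null (fun x hx => ?_) hnull
  rw [Set.mem_ofPred_eq, Set.not_subsingleton_iff] at hx
  obtain ⟨y₁, h1, y₂, h2, hne⟩ := hx
  exact ⟨(x, y₁, y₂), ⟨h1, h2, hne⟩, rfl⟩

end TwoMonotone

/-! ### Exchanging targets in an optimal coupling -/

section Exchange

variable {d : ℕ} {p : ℝ}

theorem measurable_edist_rpow (p : ℝ) : Measurable fun z : E d × E d => edist z.1 z.2 ^ p :=
  (measurable_fst.edist measurable_snd).pow_const p

/-- Exchanging the targets of pairs of independent samples whenever this is profitable. -/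
theorem IsOptimalCoupling.ae_exchange {Γ : Measure (E d × E d)} [IsProbabilityMeasure Γ]
    {ν μ : Measure (E d)} (h : IsOptimalCoupling p Γ ν μ) (hfin : cost p Γ ≠ ∞) :
    (Γ.prod Γ) {q | edist q.1.1 q.2.2 ^ p + edist q.2.1 q.1.2 ^ p <
      edist q.1.1 q.1.2 ^ p + edist q.2.1 q.2.2 ^ p} = 0 := by
  classical
  set S : Set ((E d × E d) × (E d × E d)) :=
    {q | edist q.1.1 q.2.2 ^ p + edist q.2.1 q.1.2 ^ p <
      edist q.1.1 q.1.2 ^ p + edist q.2.1 q.2.2 ^ p} with hS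
  have hSm : MeasurableSet S := measurableSet_lt (by fun_prop) (by fun_prop)
  have hswap : MeasurePreserving Prod.swap (Γ.prod Γ) (Γ.prod Γ) := Measure.measurePreserving_swap
  have hSswap : Prod.swap ⁻¹' S = S := by
    ext ⟨z, w⟩
    simp only [hS, Set.mem_preimage, Set.mem_ofPred_eq, Prod.swap_prod_mk]
    rw [add_comm (edist w.1 z.2 ^ p), add_comm (edist w.1 w.2 ^ p)]
  have hsym : ∀ f : (E d × E d) × (E d × E d) → ℝ≥0∞, Measurable f →
      ∫⁻ q in S, f q.swap ∂(Γ.prod Γ) = ∫⁻ q in S, f q ∂(Γ.prod Γ) := by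
    intro f hf
    conv_rhs => rw [← hswap.map_eq]
    rw [setLIntegral_map hSm hf measurable_swap, hSswap]
  -- The first of two independent samples takes the target of the second when swapping pays. As `S`
  -- is invariant under swapping the samples, the law of the target is unchanged, so this is a
  -- competing coupling.
  set ψ : (E d × E d) × (E d × E d) → E d := fun q => if q ∈ S then q.2.2 else q.1.2 with hψ
  have hψm : Measurable ψ := Measurable.ite hSm (by fun_prop) (by fun_prop)
  have hfst : (Γ.prod Γ).map Prod.fst = Γ := by simp
  have hcoup : IsCoupling ((Γ.prod Γ).map fun q => (q.1.1, ψ q)) ν μ := by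
    constructor
    · rw [Measure.map_map measurable_fst (by fun_prop), ← h.1.1]
      conv_rhs => rw [← hfst]
      rw [Measure.map_map measurable_fst measurable_fst]
      rfl
    · rw [Measure.map_map measurable_snd (by fun_prop), ← h.1.2]
      conv_rhs => rw [← hfst]
      rw [Measure.map_map measurable_snd measurable_fst]
      refine Measure.ext_of_lintegral _ fun f hf => ?_
      rw [lintegral_map hf (by fun_prop), lintegral_map hf (by fun_prop),
        ← lintegral_add_compl _ hSm, ← lintegral_add_compl (fun q => f ((Prod.snd ∘ Prod.fst) q)) hSm]
      congr 1
      · rw [← hsym (fun q => f ((Prod.snd ∘ Prod.fst) q)) (by fun_prop)]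
        exact setLIntegral_congr_fun hSm fun q hq => by simp [hψ, hq]
      · exact setLIntegral_congr_fun hSm.compl fun q hq => by
          simp [hψ, (Set.mem_compl_iff _ _).1 hq]
  have hle := h.2 _ hcoup
  have hcΓ : cost p Γ = ∫⁻ q, edist q.1.1 q.1.2 ^ p ∂(Γ.prod Γ) := by
    rw [cost]
    conv_lhs => rw [← hfst]
    rw [lintegral_map (measurable_edist_rpow p) measurable_fst]
  have hc' : cost p ((Γ.prod Γ).map fun q => (q.1.1, ψ q))
      = ∫⁻ q in S, edist q.1.1 q.2.2 ^ p ∂(Γ.prod Γ)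
        + ∫⁻ q in Sᶜ, edist q.1.1 q.1.2 ^ p ∂(Γ.prod Γ) := by
    rw [cost, lintegral_map (measurable_edist_rpow p) (by fun_prop), ← lintegral_add_compl _ hSm]
    congr 1
    · exact setLIntegral_congr_fun hSm fun q hq => by simp [hψ, hq]
    · exact setLIntegral_congr_fun hSm.compl fun q hq => by
        simp [hψ, (Set.mem_compl_iff _ _).1 hq]
  have hfin' := hfin
  rw [hcΓ, ← lintegral_add_compl _ hSm, ENNReal.add_ne_top] at hfin'
  rw [hc', hcΓ, ← lintegral_add_compl _ hSm] at hle
  have hle' := (ENNReal.add_le_add_iff_right hfin'.2).1 hle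
  -- By the same symmetry, both sides of the pairwise inequality integrate over `S` to twice the
  -- one-sample cost, so optimality contradicts a strict gain on a set of positive mass.
  have h1 : ∫⁻ q in S, edist q.1.1 q.1.2 ^ p + edist q.2.1 q.2.2 ^ p ∂(Γ.prod Γ)
      = 2 * ∫⁻ q in S, edist q.1.1 q.1.2 ^ p ∂(Γ.prod Γ) := by
    rw [lintegral_add_left (by fun_prop), two_mul, ← hsym (fun q => edist q.1.1 q.1.2 ^ p)
      (by fun_prop)]
    rfl
  have h2 : ∫⁻ q in S, edist q.1.1 q.2.2 ^ p + edist q.2.1 q.1.2 ^ p ∂(Γ.prod Γ)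
      = 2 * ∫⁻ q in S, edist q.1.1 q.2.2 ^ p ∂(Γ.prod Γ) := by
    rw [lintegral_add_left (by fun_prop), two_mul, ← hsym (fun q => edist q.1.1 q.2.2 ^ p)
      (by fun_prop)]
    rfl
  by_contra h0
  have hlt := setLIntegral_strict_mono (μ := Γ.prod Γ) hSm h0
    (f := fun q => edist q.1.1 q.2.2 ^ p + edist q.2.1 q.1.2 ^ p)
    (g := fun q => edist q.1.1 q.1.2 ^ p + edist q.2.1 q.2.2 ^ p) (by fun_prop)
    (by
      refine ne_top_of_le_ne_top (h1 ▸ ENNReal.mul_ne_top (by simp) hfin'.1)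
        (setLIntegral_mono (by fun_prop) fun q hq => le_of_lt hq))
    (ae_of_all _ fun q hq => hq)
  rw [h1, h2] at hlt
  exact absurd (mul_le_mul_right hle' 2) (not_le.2 hlt)

end Exchange

/-! ### Uniqueness of optimal couplings and maps -/

section Uniqueness

variable {d : ℕ} {p : ℝ}

theorem edist_rpow_eq_ofReal (hp : 0 ≤ p) (x y : E d) :
    edist x y ^ p = ENNReal.ofReal (‖x - y‖ ^ p) := by
  rw [edist_dist, dist_eq_norm, ENNReal.ofReal_rpow_of_nonneg (norm_nonneg _) hp]

/-- The support of an optimal coupling of finite cost is cost-monotone. -/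
theorem IsOptimalCoupling.costMonotone_support (hp : 0 ≤ p) {Γ : Measure (E d × E d)}
    [IsProbabilityMeasure Γ] {ν μ : Measure (E d)} (h : IsOptimalCoupling p Γ ν μ)
    (hfin : cost p Γ ≠ ∞) : CostMonotone p Γ.support := by
  intro z hz w hw
  by_contra! hlt
  set S : Set ((E d × E d) × (E d × E d)) :=
    {q | edist q.1.1 q.2.2 ^ p + edist q.2.1 q.1.2 ^ p <
      edist q.1.1 q.1.2 ^ p + edist q.2.1 q.2.2 ^ p} with hS
  have hpow : Continuous fun x : ℝ≥0∞ => x ^ p := ENNReal.continuous_rpow_const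
  have hSo : IsOpen S := isOpen_lt
    ((hpow.comp (by fun_prop)).add (hpow.comp (by fun_prop)))
    ((hpow.comp (by fun_prop)).add (hpow.comp (by fun_prop)))
  have hzw : (z, w) ∈ S := by
    simp only [hS, Set.mem_ofPred_eq, edist_rpow_eq_ofReal hp]
    rw [← ENNReal.ofReal_add (by positivity) (by positivity),
      ← ENNReal.ofReal_add (by positivity) (by positivity)]
    exact (ENNReal.ofReal_lt_ofReal_iff_of_nonneg (by positivity)).2 hlt
  obtain ⟨U, hU, V, hV, hUV⟩ := mem_nhds_prod_iff.1 (hSo.mem_nhds hzw)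
  have h0 : (Γ.prod Γ) (U ×ˢ V) = 0 := measure_mono_null hUV (h.ae_exchange hfin)
  rw [Measure.prod_prod, mul_eq_zero] at h0
  rcases h0 with h0 | h0
  · exact (((Measure.mem_support_iff_forall z).1 hz) U hU).ne' h0
  · exact (((Measure.mem_support_iff_forall w).1 hw) V hV).ne' h0

theorem IsCoupling.isProbabilityMeasure {Γ : Measure (E d × E d)} {ν μ : Measure (E d)}
    [IsProbabilityMeasure ν] (h : IsCoupling Γ ν μ) : IsProbabilityMeasure Γ := by
  refine ⟨?_⟩
  rw [← measure_univ (μ := ν), ← h.1, Measure.map_apply measurable_fst MeasurableSet.univ,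
    Set.preimage_univ]

/-- Two optimal couplings of finite cost are concentrated on a common set, whose sections are
almost surely subsingletons. -/
theorem IsOptimalCoupling.exists_common_graph (hp : 1 < p) {ν μ : Measure (E d)}
    [IsProbabilityMeasure ν] (hνac : ν ≪ volume) {Γ₁ Γ₂ : Measure (E d × E d)}
    (h₁ : IsOptimalCoupling p Γ₁ ν μ) (h₂ : IsOptimalCoupling p Γ₂ ν μ)
    (hfin : cost p Γ₁ ≠ ∞) :
    ∃ G : Set (E d × E d), IsClosed G ∧ Γ₁ Gᶜ = 0 ∧ Γ₂ Gᶜ = 0 ∧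
      ∀ᵐ y ∂ν, {x | (y, x) ∈ G}.Subsingleton := by
  have hcost : cost p Γ₂ = cost p Γ₁ := le_antisymm (h₂.2 _ h₁.1) (h₁.2 _ h₂.1)
  -- The cost is linear, so the average is optimal as well; its support is cost-monotone and carries
  -- both couplings.
  set Γ : Measure (E d × E d) := (2⁻¹ : ℝ≥0∞) • (Γ₁ + Γ₂) with hΓ
  have hhalf : ∀ m : Measure (E d), (2⁻¹ : ℝ≥0∞) • (m + m) = m := by
    intro m
    rw [← two_smul ℝ≥0∞ m, smul_smul, ENNReal.inv_mul_cancel (by simp) (by simp), one_smul]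
  have hc : IsCoupling Γ ν μ := by
    constructor
    · rw [hΓ, Measure.map_smul, Measure.map_add _ _ measurable_fst, h₁.1.1, h₂.1.1, hhalf]
    · rw [hΓ, Measure.map_smul, Measure.map_add _ _ measurable_snd, h₁.1.2, h₂.1.2, hhalf]
  have hcΓ : cost p Γ = cost p Γ₁ := by
    have : cost p Γ = 2⁻¹ * (cost p Γ₁ + cost p Γ₂) := by
      simp only [cost, hΓ, lintegral_smul_measure, lintegral_add_measure, smul_eq_mul]
    rw [this, hcost, ← two_mul, ← mul_assoc, ENNReal.inv_mul_cancel (by simp) (by simp), one_mul]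
  have hopt : IsOptimalCoupling p Γ ν μ := ⟨hc, fun Υ hΥ => hcΓ ▸ h₁.2 _ hΥ⟩
  have := hc.isProbabilityMeasure
  have hmono := hopt.costMonotone_support (by linarith) (hcΓ ▸ hfin)
  have hsupp : ((2⁻¹ : ℝ≥0∞) • (Γ₁ + Γ₂)) Γ.supportᶜ = 0 := Measure.measure_compl_support
  have h0 : Γ₁ Γ.supportᶜ = 0 ∧ Γ₂ Γ.supportᶜ = 0 := by
    rw [Measure.smul_apply, Measure.add_apply, smul_eq_mul, mul_eq_zero] at hsupp
    simpa using hsupp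
  exact ⟨Γ.support, Measure.isClosed_support, h0.1, h0.2, hνac.ae_le (hmono.ae_subsingleton hp)⟩

/-- A probability measure concentrated on a subsingleton is the Dirac mass at its mean. -/
theorem eq_dirac_integral_of_subsingleton {m : Measure (E d)} [IsProbabilityMeasure m]
    {A : Set (E d)} (hA : A.Subsingleton) (hm : m Aᶜ = 0) : m = Measure.dirac (∫ x, x ∂m) := by
  have hne : A.Nonempty := by
    by_contra hne
    rw [Set.not_nonempty_iff_eq_empty.1 hne, Set.compl_empty, measure_univ] at hm
    exact one_ne_zero hm
  obtain ⟨a, ha⟩ := hne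
  rw [hA.eq_singleton_of_mem ha] at hm
  have hae : ∀ᵐ x ∂m, x = a := by
    rw [ae_iff]; exact hm
  have hd : m = Measure.dirac a := by
    refine Measure.ext fun B hB => ?_
    rw [Measure.dirac_apply' _ hB]
    by_cases haB : a ∈ B
    · rw [Set.indicator_of_mem haB, Pi.one_apply, ← prob_compl_eq_zero_iff hB]
      exact measure_mono_null (fun x hx => by rintro rfl; exact hx haB) hm
    · rw [Set.indicator_of_notMem haB]
      exact measure_mono_null (fun x hx => by rintro rfl; exact haB hx) hm
  have hmean : ∫ x, x ∂m = a := by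
    rw [integral_congr_ae hae]; simp
  rw [hmean, ← hd]

/-- A coupling concentrated on a set with subsingleton sections is induced by the map sending a
point to the barycenter of its conditional law. -/
theorem compProd_eq_map_integral {ν : Measure (E d)} [IsProbabilityMeasure ν]
    (κ : Kernel (E d) (E d)) [IsMarkovKernel κ] {G : Set (E d × E d)} (hG : MeasurableSet G)
    (h0 : (ν ⊗ₘ κ) Gᶜ = 0) (hsub : ∀ᵐ y ∂ν, {x | (y, x) ∈ G}.Subsingleton) :
    ν ⊗ₘ κ = ν.map (fun y => (y, ∫ x, x ∂(κ y))) := by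
  have hmeas : Measurable fun y => ∫ x, x ∂(κ y) :=
    (StronglyMeasurable.integral_kernel stronglyMeasurable_id).measurable
  have hae : ∀ᵐ y ∂ν, κ y = Kernel.deterministic _ hmeas y := by
    rw [Measure.compProd_apply hG.compl, lintegral_eq_zero_iff
      (Kernel.measurable_kernel_prodMk_left hG.compl)] at h0
    filter_upwards [h0, hsub] with y hy hys
    rw [Kernel.deterministic_apply]
    exact eq_dirac_integral_of_subsingleton hys hy
  rw [Measure.compProd_congr hae, Measure.compProd_deterministic]

theorem eq_map_integral_condKernel {Γ : Measure (E d × E d)} {ν : Measure (E d)}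
    [IsProbabilityMeasure ν] [IsProbabilityMeasure Γ] (hν : Γ.map Prod.fst = ν)
    {G : Set (E d × E d)} (hG : MeasurableSet G)
    (h0 : Γ Gᶜ = 0) (hsub : ∀ᵐ y ∂ν, {x | (y, x) ∈ G}.Subsingleton) :
    Γ = ν.map (fun y => (y, ∫ x, x ∂(Γ.condKernel y))) := by
  have hdis : ν ⊗ₘ Γ.condKernel = Γ := by
    rw [← hν]; exact Γ.disintegrate Γ.condKernel
  rw [← hdis] at h0
  conv_lhs => rw [← hdis]
  exact compProd_eq_map_integral _ hG h0 hsub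

theorem ae_eq_of_graph {ν : Measure (E d)} {S₁ S₂ : E d → E d} (hS₁ : Measurable S₁)
    (hS₂ : Measurable S₂) {G : Set (E d × E d)} (hG : MeasurableSet G)
    (h₁ : ν.map (fun y => (y, S₁ y)) Gᶜ = 0) (h₂ : ν.map (fun y => (y, S₂ y)) Gᶜ = 0)
    (hsub : ∀ᵐ y ∂ν, {x | (y, x) ∈ G}.Subsingleton) : S₁ =ᵐ[ν] S₂ := by
  rw [Measure.map_apply (by fun_prop) hG.compl] at h₁ h₂
  have h₁' : ∀ᵐ y ∂ν, (y, S₁ y) ∈ G := h₁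
  have h₂' : ∀ᵐ y ∂ν, (y, S₂ y) ∈ G := h₂
  filter_upwards [h₁', h₂', hsub] with y hy₁ hy₂ hs using hs hy₁ hy₂

/-- Optimal couplings of finite cost are unique. -/
theorem IsOptimalCoupling.unique (hp : 1 < p) {ν μ : Measure (E d)}
    [IsProbabilityMeasure ν] (hνac : ν ≪ volume) {Γ₁ Γ₂ : Measure (E d × E d)}
    (h₁ : IsOptimalCoupling p Γ₁ ν μ) (h₂ : IsOptimalCoupling p Γ₂ ν μ)
    (hfin : cost p Γ₁ ≠ ∞) : Γ₁ = Γ₂ := by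
  obtain ⟨G, hG, h01, h02, hsub⟩ := h₁.exists_common_graph hp hνac h₂ hfin
  have := h₁.1.isProbabilityMeasure
  have := h₂.1.isProbabilityMeasure
  have e₁ := eq_map_integral_condKernel h₁.1.1 hG.measurableSet h01 hsub
  have e₂ := eq_map_integral_condKernel h₂.1.1 hG.measurableSet h02 hsub
  rw [e₁] at h01
  rw [e₂] at h02
  have hae := ae_eq_of_graph
    (StronglyMeasurable.integral_kernel stronglyMeasurable_id).measurable
    (StronglyMeasurable.integral_kernel stronglyMeasurable_id).measurable
    hG.measurableSet h01 h02 hsub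
  rw [e₁, e₂]
  refine Measure.map_congr ?_
  filter_upwards [hae] with y hy using congrArg (Prod.mk y) hy

/-- Optimal maps of finite cost are unique. -/
theorem IsOptimalMap.ae_unique (hp : 1 < p) {ν μ : Measure (E d)}
    [IsProbabilityMeasure ν] (hνac : ν ≪ volume) {S₁ S₂ : E d → E d}
    (h₁ : IsOptimalMap p ν μ S₁) (h₂ : IsOptimalMap p ν μ S₂)
    (hfin : cost p (ν.map fun y => (y, S₁ y)) ≠ ∞) : S₁ =ᵐ[ν] S₂ := by
  obtain ⟨G, hG, h01, h02, hsub⟩ := h₁.2.exists_common_graph hp hνac h₂.2 hfin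
  exact ae_eq_of_graph h₁.1 h₂.1 hG.measurableSet h01 h02 hsub

end Uniqueness

/-! ### Weak compactness and existence of optimal couplings -/

section Compactness

variable {d : ℕ} {p : ℝ}

/-- The cost is the supremum of the integrals of the truncations `min (|x - y|^p) n`, each weakly
continuous, hence it is lower semicontinuous. -/
theorem isClosed_cost_le (hp : 0 ≤ p) (C : ℝ≥0∞) :
    IsClosed {Γ : ProbabilityMeasure (E d × E d) | cost p (Γ : Measure (E d × E d)) ≤ C} := by
  let g : E d × E d → ℝ≥0 := fun z => nndist z.1 z.2 ^ p
  have hg : Continuous g :=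
    (NNReal.continuous_rpow_const hp).comp (continuous_fst.nndist continuous_snd)
  let f : ℕ → E d × E d →ᵇ ℝ≥0 := fun n =>
    BoundedContinuousFunction.mkOfBound ⟨fun z => min (g z) n, by fun_prop⟩ n (by
      intro x y
      rw [NNReal.dist_eq, abs_le]
      have h1 : (min (g x) n : ℝ≥0) ≤ (n : ℝ) := by exact_mod_cast min_le_right _ _
      have h2 : (min (g y) n : ℝ≥0) ≤ (n : ℝ) := by exact_mod_cast min_le_right _ _
      have h3 := (min (g x) (n : ℝ≥0)).coe_nonneg
      have h4 := (min (g y) (n : ℝ≥0)).coe_nonneg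
      constructor <;> simp only [ContinuousMap.coe_mk] <;> linarith)
  have hsup : ∀ Γ : ProbabilityMeasure (E d × E d), cost p (Γ : Measure (E d × E d))
      = ⨆ n, ∫⁻ z, (f n z : ℝ≥0∞) ∂(Γ : Measure (E d × E d)) := by
    intro Γ
    rw [← lintegral_iSup (f := fun n z => (f n z : ℝ≥0∞))
      (fun n => (f n).continuous.measurable.coe_nnreal_ennreal)
      (fun m n hmn z => ENNReal.coe_le_coe.2
        (min_le_min_left (g z) (by exact_mod_cast hmn : (m : ℝ≥0) ≤ n)))]
    refine lintegral_congr fun z => ?_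
    have hz : edist z.1 z.2 ^ p = (g z : ℝ≥0∞) := by
      rw [edist_nndist, ENNReal.coe_rpow_of_nonneg _ hp]
    rw [hz]
    refine le_antisymm ?_ (iSup_le fun n => ENNReal.coe_le_coe.2 (min_le_left _ _))
    obtain ⟨n, hn⟩ := exists_nat_ge (g z)
    exact le_iSup_of_le n (ENNReal.coe_le_coe.2 (le_min le_rfl hn))
  have : {Γ : ProbabilityMeasure (E d × E d) | cost p (Γ : Measure (E d × E d)) ≤ C}
      = ⋂ n, {Γ : ProbabilityMeasure (E d × E d) |
        ∫⁻ z, (f n z : ℝ≥0∞) ∂(Γ : Measure (E d × E d)) ≤ C} := by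
    ext Γ
    simp [hsup]
  rw [this]
  exact isClosed_iInter fun n => isClosed_le
    (ProbabilityMeasure.continuous_lintegral_boundedContinuousFunction (f n)) continuous_const

theorem exists_toMeasure_eq {X : Type*} [MeasurableSpace X] (m : Measure X)
    [h : IsProbabilityMeasure m] : ∃ m' : ProbabilityMeasure X, (m' : Measure X) = m :=
  ⟨⟨m, h⟩, rfl⟩

theorem isClosed_map_eq {X Y : Type*} [MeasurableSpace X] [TopologicalSpace X]
    [OpensMeasurableSpace X] [MeasurableSpace Y] [TopologicalSpace Y] [BorelSpace Y]
    [HasOuterApproxClosed Y] {g : X → Y} (hg : Continuous g) (ν : Measure Y)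
    [IsProbabilityMeasure ν] : IsClosed {Γ : ProbabilityMeasure X | (Γ : Measure X).map g = ν} := by
  obtain ⟨ν', rfl⟩ := exists_toMeasure_eq ν
  have : {Γ : ProbabilityMeasure X | (Γ : Measure X).map g = ν'}
      = (fun Γ : ProbabilityMeasure X => Γ.map (f := g) hg.measurable.aemeasurable) ⁻¹' {ν'} := by
    ext Γ
    rw [Set.mem_preimage, Set.mem_singleton_iff,
      ← ProbabilityMeasure.toMeasure_injective.eq_iff]
    rfl
  rw [this]
  exact isClosed_singleton.preimage (ProbabilityMeasure.continuous_map hg)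

/-- The measures of bounded cost with a given first marginal form a compact set. -/
theorem isCompact_cost_le (hp : 0 < p) (ν : Measure (E d)) [IsProbabilityMeasure ν] {C : ℝ≥0∞}
    (hC : C ≠ ∞) :
    IsCompact {Γ : ProbabilityMeasure (E d × E d) | (Γ : Measure (E d × E d)).map Prod.fst = ν ∧
      cost p (Γ : Measure (E d × E d)) ≤ C} := by
  have hcl : IsClosed {Γ : ProbabilityMeasure (E d × E d) |
      (Γ : Measure (E d × E d)).map Prod.fst = ν ∧ cost p (Γ : Measure (E d × E d)) ≤ C} :=
    (isClosed_map_eq continuous_fst ν).inter (isClosed_cost_le hp.le C)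
  rw [← hcl.closure_eq]
  refine isCompact_closure_of_isTightMeasureSet ?_
  rw [isTightMeasureSet_iff_exists_isCompact_measure_compl_le]
  intro ε hε
  have hε2 : 0 < ε / 2 := ENNReal.half_pos hε.ne'
  obtain ⟨K, hK, hKε⟩ := (isTightMeasureSet_iff_exists_isCompact_measure_compl_le.1
    (isTightMeasureSet_singleton (μ := ν))) (ε / 2) hε2
  obtain ⟨R, hR, hCR⟩ : ∃ R : ℝ≥0, 0 < R ∧ C / (R : ℝ≥0∞) ^ p ≤ ε / 2 := by
    have ht : Tendsto (fun n : ℕ => C / ((n : ℝ≥0) : ℝ≥0∞) ^ p) atTop (𝓝 0) := by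
      have h1 : Tendsto (fun n : ℕ => (((n : ℝ≥0) : ℝ≥0∞)) ^ p) atTop (𝓝 ∞) := by
        have := (ENNReal.continuous_rpow_const (y := p)).tendsto ∞
        rw [ENNReal.top_rpow_of_pos hp] at this
        refine this.comp ?_
        simpa using ENNReal.tendsto_nat_nhds_top
      simpa using ENNReal.Tendsto.const_div h1 (Or.inr hC)
    obtain ⟨n, hn, hn0⟩ := ((ht.eventually_le_const hε2).and (eventually_gt_atTop 0)).exists
    exact ⟨n, by exact_mod_cast hn0, hn⟩
  -- Tightness: by Markov's inequality the points move by at least `R` only with mass at most `C /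
  -- R^p`, so those starting in `K` mostly land in its closed thickening, which is compact in `ℝ^d`.
  refine ⟨K ×ˢ Metric.cthickening R K, hK.prod hK.cthickening, ?_⟩
  rintro _ ⟨Γ, ⟨hΓν, hΓC⟩, rfl⟩
  have hsub : (K ×ˢ Metric.cthickening R K)ᶜ ⊆
      (Prod.fst ⁻¹' Kᶜ) ∪ {z : E d × E d | (R : ℝ≥0∞) ^ p ≤ edist z.1 z.2 ^ p} := by
    rintro ⟨x, y⟩ hxy
    by_cases hx : x ∈ K
    · right
      by_contra hlt
      refine hxy ⟨hx, ?_⟩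
      have h2 : edist x y < R := by
        rw [Set.mem_ofPred_eq, not_le, ENNReal.rpow_lt_rpow_iff hp] at hlt
        exact hlt
      refine Metric.mem_cthickening_of_edist_le y x R K hx ?_
      rw [edist_comm]
      simpa using h2.le
    · exact Or.inl hx
  calc (Γ : Measure (E d × E d)) (K ×ˢ Metric.cthickening R K)ᶜ
      ≤ (Γ : Measure (E d × E d)) (Prod.fst ⁻¹' Kᶜ)
        + (Γ : Measure (E d × E d)) {z : E d × E d | (R : ℝ≥0∞) ^ p ≤ edist z.1 z.2 ^ p} :=
        (measure_mono hsub).trans (measure_union_le _ _)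
    _ ≤ ε / 2 + ε / 2 := by
        gcongr
        · rw [← Measure.map_apply measurable_fst hK.isClosed.measurableSet.compl, hΓν]
          exact hKε ν rfl
        · refine (meas_ge_le_lintegral_div (measurable_edist_rpow p).aemeasurable ?_ ?_).trans
            ((ENNReal.div_le_div_right hΓC _).trans hCR)
          · simp [hR.ne']
          · simp [hp.le]
    _ = ε := ENNReal.add_halves ε

theorem cost_prod_lt_top (hp : 1 ≤ p) {ν μ : Measure (E d)} (hν : MemPp p ν) (hμ : MemPp p μ) :
    cost p (ν.prod μ) < ∞ := by
  have := hν.1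
  have := hμ.1
  have hle : ∀ z : E d × E d, edist z.1 z.2 ^ p ≤ 2 ^ (p - 1) * (‖z.1‖ₑ ^ p + ‖z.2‖ₑ ^ p) := by
    intro z
    refine le_trans ?_ (ENNReal.rpow_add_le_mul_rpow_add_rpow _ _ hp)
    refine ENNReal.rpow_le_rpow ?_ (by linarith)
    rw [edist_eq_enorm_sub]
    exact enorm_sub_le
  refine (lintegral_mono hle).trans_lt ?_
  rw [lintegral_const_mul _ (by fun_prop), lintegral_add_left (by fun_prop)]
  refine ENNReal.mul_lt_top (ENNReal.rpow_lt_top_of_nonneg (by linarith) (by simp)) (ENNReal.add_lt_top.2 ⟨?_, ?_⟩)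
  · rw [lintegral_prod _ (by fun_prop)]
    simpa using hν.2
  · rw [lintegral_prod _ (by fun_prop)]
    simpa using hμ.2

/-- Direct method: minimize a lower semicontinuous cost over the compact set of couplings at most as
expensive as the independent one. -/
theorem exists_isOptimalCoupling (hp : 1 ≤ p) {ν μ : Measure (E d)} (hν : MemPp p ν)
    (hμ : MemPp p μ) : ∃ Γ, IsOptimalCoupling p Γ ν μ ∧ cost p Γ < ∞ := by
  have := hν.1
  have := hμ.1
  set C := cost p (ν.prod μ) with hC
  have hCfin := cost_prod_lt_top hp hν hμ
  let K : Set (ProbabilityMeasure (E d × E d)) := {Γ |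
    ((Γ : Measure (E d × E d)).map Prod.fst = ν ∧ cost p (Γ : Measure (E d × E d)) ≤ C) ∧
    (Γ : Measure (E d × E d)).map Prod.snd = μ}
  have hK : IsCompact K :=
    (isCompact_cost_le (by linarith) ν hCfin.ne).inter_right (isClosed_map_eq continuous_snd μ)
  have hlsc : LowerSemicontinuous fun Γ : ProbabilityMeasure (E d × E d) =>
      cost p (Γ : Measure (E d × E d)) :=
    lowerSemicontinuous_iff_isClosed_preimage.2 fun c => isClosed_cost_le (by linarith) c
  obtain ⟨m, hm⟩ := exists_toMeasure_eq (ν.prod μ)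
  obtain ⟨Γ, ⟨⟨hΓ1, hΓC⟩, hΓ2⟩, hmin⟩ := LowerSemicontinuousOn.exists_isMinOn (s := K)
    ⟨m, ⟨by simp [hm], by rw [hm]⟩, by simp [hm]⟩ hK (hlsc.lowerSemicontinuousOn _)
  refine ⟨Γ, ⟨⟨hΓ1, hΓ2⟩, fun Υ hΥ => ?_⟩, hΓC.trans_lt hCfin⟩
  by_cases hΥC : cost p Υ ≤ C
  · have := hΥ.isProbabilityMeasure
    obtain ⟨Υ', rfl⟩ := exists_toMeasure_eq Υ
    exact hmin (a := Υ') ⟨⟨hΥ.1, hΥC⟩, hΥ.2⟩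
  · exact hΓC.trans (le_of_not_ge hΥC)

end Compactness

/-! ### Measurable selection of optimal couplings and maps -/

section Selection

variable {d : ℕ} {p : ℝ} {Ω : Type*} [MeasurableSpace Ω]

theorem continuous_charFun_apply {F : Type*} [NormedAddCommGroup F] [InnerProductSpace ℝ F]
    [MeasurableSpace F] [OpensMeasurableSpace F] (t : F) :
    Continuous fun m : ProbabilityMeasure F => charFun (m : Measure F) t := by
  rw [continuous_iff_continuousAt]
  intro m
  simp only [ContinuousAt, charFun_eq_integral_innerProbChar]
  exact (ProbabilityMeasure.tendsto_iff_forall_integral_rclike_tendsto ℂ).1 tendsto_id _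

/-- If `K` is a compact set of measures on the product, then the event that `μ ω` is the second
marginal of an element of `K` is measurable. -/
theorem measurableSet_exists_map_snd_eq (μ : Kernel Ω (E d)) [IsMarkovKernel μ]
    {K : Set (ProbabilityMeasure (E d × E d))} (hK : IsCompact K) :
    MeasurableSet {ω | ∃ Γ ∈ K, (Γ : Measure (E d × E d)).map Prod.snd = μ ω} := by
  let t : ℕ → E d := TopologicalSpace.denseSeq (E d)
  have ht : DenseRange t := TopologicalSpace.denseRange_denseSeq _
  -- Characteristic functions on a dense sequence determine the second marginal. The image of `K` is
  -- compact, hence closed, so the event is the preimage of a closed set and no projection theorem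
  -- is needed.
  let Φ : ProbabilityMeasure (E d × E d) → ℕ → ℂ := fun Γ k =>
    charFun ((Γ : Measure (E d × E d)).map Prod.snd) (t k)
  have hΦ : Continuous Φ := by
    refine continuous_pi fun k => ?_
    exact (continuous_charFun_apply (t k)).comp
      (ProbabilityMeasure.continuous_map (Ω := E d × E d) continuous_snd)
  have hΨ : Measurable fun ω (k : ℕ) => charFun (μ ω) (t k) := by
    refine measurable_pi_lambda _ fun k => ?_
    simp only [charFun_eq_integral_innerProbChar]
    exact (StronglyMeasurable.integral_kernel
      (BoundedContinuousFunction.innerProbChar (t k)).continuous.stronglyMeasurable).measurable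
  have heq : {ω | ∃ Γ ∈ K, (Γ : Measure (E d × E d)).map Prod.snd = μ ω}
      = (fun ω (k : ℕ) => charFun (μ ω) (t k)) ⁻¹' (Φ '' K) := by
    ext ω
    constructor
    · rintro ⟨Γ, hΓ, h⟩
      exact ⟨Γ, hΓ, funext fun k => by simp only [Φ, h]⟩
    · rintro ⟨Γ, hΓ, h⟩
      refine ⟨Γ, hΓ, ?_⟩
      have := Measure.isProbabilityMeasure_map (μ := (Γ : Measure (E d × E d)))
        measurable_snd.aemeasurable
      refine Measure.ext_of_charFun ?_
      exact ht.equalizer continuous_charFun continuous_charFun h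
  rw [heq]
  exact hΨ (hK.image hΦ).isClosed.measurableSet

/-- Closed sets form a generating π-system, and their indicators are limits of bounded continuous
functions. -/
theorem measurable_of_measurable_lintegral {X : Type*} [TopologicalSpace X] [MeasurableSpace X]
    [BorelSpace X] [HasOuterApproxClosed X] {m : Ω → Measure X} [∀ ω, IsProbabilityMeasure (m ω)]
    (h : ∀ f : X →ᵇ ℝ≥0, Measurable fun ω => ∫⁻ x, (f x : ℝ≥0∞) ∂(m ω)) : Measurable m := by
  refine Measurable.measure_of_isPiSystem_of_isProbabilityMeasure
    ((BorelSpace.measurable_eq (α := X)).trans borel_eq_generateFrom_isClosed) isPiSystem_isClosed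
    fun F hF => ?_
  exact measurable_of_tendsto_metrizable (fun n => h (hF.apprSeq n))
    (tendsto_pi_nhds.2 fun ω => HasOuterApproxClosed.tendsto_lintegral_apprSeq hF (m ω))

/-- The optimal couplings of `ν` with a random measure can be chosen measurably. -/
theorem exists_kernel_isOptimalCoupling (hp : 1 < p) {ν : Measure (E d)} (hν : MemPp p ν)
    (hνac : ν ≪ volume) (μ : Kernel Ω (E d)) (hμ : ∀ ω, MemPp p (μ ω)) :
    ∃ Γ : Kernel Ω (E d × E d), IsMarkovKernel Γ ∧
      ∀ ω, IsOptimalCoupling p (Γ ω) ν (μ ω) ∧ cost p (Γ ω) < ∞ := by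
  have := hν.1
  have : IsMarkovKernel μ := ⟨fun ω => (hμ ω).1⟩
  -- An arbitrary choice of optimal couplings; uniqueness is what forces it to be measurable.
  choose G hG hGfin using fun ω => exists_isOptimalCoupling hp.le hν (hμ ω)
  have hGprob : ∀ ω, IsProbabilityMeasure (G ω) := fun ω => (hG ω).1.isProbabilityMeasure
  suffices hmeas : Measurable G from ⟨⟨G, hmeas⟩, ⟨hGprob⟩, fun ω => ⟨hG ω, hGfin ω⟩⟩
  refine measurable_of_measurable_lintegral fun f => measurable_of_Iic fun a => ?_
  let K : ℝ≥0∞ → Set (ProbabilityMeasure (E d × E d)) := fun C =>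
    {Γ | (Γ : Measure (E d × E d)).map Prod.fst = ν ∧ cost p (Γ : Measure (E d × E d)) ≤ C}
  let K' : ℝ≥0∞ → Set (ProbabilityMeasure (E d × E d)) := fun C =>
    K C ∩ {Γ | ∫⁻ z, (f z : ℝ≥0∞) ∂(Γ : Measure (E d × E d)) ≤ a}
  have hK : ∀ C, C ≠ ∞ → IsCompact (K C) := fun C hC => isCompact_cost_le (by linarith) ν hC
  have hfcl : IsClosed {Γ : ProbabilityMeasure (E d × E d) |
      ∫⁻ z, (f z : ℝ≥0∞) ∂(Γ : Measure (E d × E d)) ≤ a} :=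
    isClosed_le (ProbabilityMeasure.continuous_lintegral_boundedContinuousFunction f)
      continuous_const
  have hK' : ∀ C, C ≠ ∞ → IsCompact (K' C) := fun C hC => (hK C hC).inter_right hfcl
  -- By uniqueness, the optimal coupling satisfies the bound iff, for every rational `q`, a coupling
  -- of cost at most `q`, if there is one, can be found that also satisfies it.
  have heq : (fun ω => ∫⁻ z, (f z : ℝ≥0∞) ∂(G ω)) ⁻¹' Set.Iic a =
      ⋂ q : ℚ≥0, ({ω | ∃ Γ ∈ K (((q : ℝ≥0) : ℝ≥0∞)),
          (Γ : Measure (E d × E d)).map Prod.snd = μ ω}ᶜ ∪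
        {ω | ∃ Γ ∈ K' (((q : ℝ≥0) : ℝ≥0∞)),
          (Γ : Measure (E d × E d)).map Prod.snd = μ ω}) := by
    ext ω
    obtain ⟨g, hg⟩ := exists_toMeasure_eq (G ω)
    simp only [Set.mem_preimage, Set.mem_Iic, Set.mem_iInter, Set.mem_union, Set.mem_compl_iff]
    constructor
    · intro ha q
      by_cases hq : cost p (G ω) ≤ ((q : ℝ≥0) : ℝ≥0∞)
      · right
        refine ⟨g, ⟨⟨?_, ?_⟩, ?_⟩, ?_⟩
        · rw [hg]; exact (hG ω).1.1
        · rw [hg]; exact hq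
        · rw [Set.mem_ofPred_eq, hg]; exact ha
        · rw [hg]; exact (hG ω).1.2
      · left
        rintro ⟨Γ, ⟨h1, h2⟩, h3⟩
        exact hq (((hG ω).2 _ ⟨h1, h3⟩).trans h2)
    · intro h
      let ι := {q : ℚ≥0 // cost p (G ω) < ((q : ℝ≥0) : ℝ≥0∞)}
      let t : ι → Set (ProbabilityMeasure (E d × E d)) := fun q =>
        K' ((((q : ℚ≥0) : ℝ≥0) : ℝ≥0∞)) ∩
          {Γ | (Γ : Measure (E d × E d)).map Prod.snd = μ ω}
      have hsq : ∀ b : ℝ≥0∞, cost p (G ω) < b →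
          ∃ q : ℚ≥0, cost p (G ω) < ((q : ℝ≥0) : ℝ≥0∞) ∧ ((q : ℝ≥0) : ℝ≥0∞) < b := by
        intro b hb
        obtain ⟨q, hq0, hq1, hq2⟩ := ENNReal.lt_iff_exists_rat_btwn.1 hb
        lift q to ℚ≥0 using hq0
        have hq : Real.toNNReal ((q : ℚ) : ℝ) = (q : ℝ≥0) := by
          refine NNReal.eq ?_
          rw [Real.coe_toNNReal _ (by exact_mod_cast q.2)]
          exact Real.ext_cauchy rfl
        rw [hq] at hq1 hq2
        exact ⟨q, hq1, hq2⟩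
      have hne : Nonempty ι := by
        obtain ⟨q, hq, -⟩ := hsq ∞ (hGfin ω)
        exact ⟨⟨q, hq⟩⟩
      have htcl : IsClosed {Γ : ProbabilityMeasure (E d × E d) |
          (Γ : Measure (E d × E d)).map Prod.snd = μ ω} := isClosed_map_eq continuous_snd (μ ω)
      have htc : ∀ q, IsCompact (t q) := fun q => (hK' _ ENNReal.coe_ne_top).inter_right htcl
      have hmono : ∀ q r : ι, (q : ℚ≥0) ≤ r → t q ⊆ t r := by
        rintro q r hqr Γ ⟨⟨⟨h1, h2⟩, h3⟩, h4⟩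
        exact ⟨⟨⟨h1, h2.trans (by exact_mod_cast hqr)⟩, h3⟩, h4⟩
      -- As `q` decreases to the optimal cost these compact sets are nested; a common point is an
      -- optimal coupling, hence `G ω`, and it satisfies the bound.
      obtain ⟨Γ, hΓ⟩ := IsCompact.nonempty_iInter_of_directed_nonempty_isCompact_isClosed t
        (by
          intro q r
          rcases le_total (q : ℚ≥0) r with h | h
          · exact ⟨q, subset_rfl, hmono _ _ h⟩
          · exact ⟨r, hmono _ _ h, subset_rfl⟩)
        (by
          rintro ⟨q, hq⟩
          rcases h q with h | ⟨Γ, h1, h2⟩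
          · refine absurd ⟨g, ⟨?_, ?_⟩, ?_⟩ h
            · rw [hg]; exact (hG ω).1.1
            · rw [hg]; exact hq.le
            · rw [hg]; exact (hG ω).1.2
          · exact ⟨Γ, h1, h2⟩)
        htc (fun q => (htc q).isClosed)
      rw [Set.mem_iInter] at hΓ
      obtain ⟨q₀⟩ := hne
      have hcoup : IsCoupling (Γ : Measure (E d × E d)) ν (μ ω) :=
        ⟨(hΓ q₀).1.1.1, (hΓ q₀).2⟩
      have hle : cost p (Γ : Measure (E d × E d)) ≤ cost p (G ω) := by
        refine le_of_forall_gt fun b hb => ?_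
        obtain ⟨q, hq1, hq2⟩ := hsq b hb
        exact (hΓ ⟨q, hq1⟩).1.1.2.trans_lt hq2
      have hopt : IsOptimalCoupling p (Γ : Measure (E d × E d)) ν (μ ω) :=
        ⟨hcoup, fun Υ hΥ => hle.trans ((hG ω).2 Υ hΥ)⟩
      rw [(hG ω).unique hp hνac hopt (hGfin ω).ne]
      exact (hΓ q₀).1.2
  rw [heq]
  refine MeasurableSet.iInter fun q => MeasurableSet.union ?_ ?_
  · exact (measurableSet_exists_map_snd_eq μ (hK _ ENNReal.coe_ne_top)).compl
  · exact measurableSet_exists_map_snd_eq μ (hK' _ ENNReal.coe_ne_top)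

/-- The optimal maps from `ν` to a random measure can be chosen jointly measurably. -/
theorem exists_measurable_isOptimalMap (hp : 1 < p) {ν : Measure (E d)} (hν : MemPp p ν)
    (hνac : ν ≪ volume) (μ : Kernel Ω (E d)) (hμ : ∀ ω, MemPp p (μ ω)) :
    ∃ X : Ω × E d → E d, Measurable X ∧ ∀ ω, IsOptimalMap p ν (μ ω) (fun y => X (ω, y)) ∧
      cost p (ν.map fun y => (y, X (ω, y))) < ∞ := by
  have := hν.1
  obtain ⟨Γ, hΓ, hopt⟩ := exists_kernel_isOptimalCoupling hp hν hνac μ hμ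
  -- The conditional kernel of a kernel is measurable in `(ω, y)` jointly, and so is its barycenter.
  have hX : Measurable fun z : Ω × E d => ∫ x, x ∂(Γ.condKernel z) :=
    (StronglyMeasurable.integral_kernel stronglyMeasurable_id).measurable
  refine ⟨_, hX, fun ω => ?_⟩
  have hfst : Γ.fst ω = ν := by
    rw [Kernel.fst_apply]; exact (hopt ω).1.1.1
  have hdis : ν ⊗ₘ (Γ.condKernel.sectR ω) = Γ ω := by
    rw [← hfst, ← Kernel.compProd_apply_eq_compProd_sectR, Γ.disintegrate]
  obtain ⟨G, hG, h0, -, hsub⟩ := (hopt ω).1.exists_common_graph hp hνac (hopt ω).1 (hopt ω).2.ne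
  rw [← hdis] at h0
  have hmap := compProd_eq_map_integral _ hG.measurableSet h0 hsub
  rw [hdis] at hmap
  have hmap' : ν.map (fun y => (y, ∫ x, x ∂(Γ.condKernel (ω, y)))) = Γ ω := hmap.symm
  refine ⟨⟨hX.comp (by fun_prop), ?_⟩, ?_⟩
  · rw [hmap']; exact (hopt ω).1
  · rw [hmap']; exact (hopt ω).2

/-- For a random measure with finite moments, the chosen optimal maps agree almost surely with
a jointly measurable function, and they are unique. -/
theorem exists_measurable_ae_eq_optMap (hp : 1 < p) {P : Measure Ω} [IsProbabilityMeasure P]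
    {ν : Measure (E d)} (hν : MemPp p ν)
    (hνac : ν ≪ volume) (μ : Kernel Ω (E d)) (hμ : MemPpΩ p P μ) :
    ∃ X : Ω × E d → E d, Measurable X ∧ ∀ᵐ ω ∂P,
      IsOptimalMap p ν (μ ω) (optMap p ν (μ ω)) ∧
      (∀ S, IsOptimalMap p ν (μ ω) S → S =ᵐ[ν] optMap p ν (μ ω)) ∧
      (fun y => X (ω, y)) =ᵐ[ν] optMap p ν (μ ω) := by
  classical
  have := hν.1
  set A : Set Ω := {ω | μ ω Set.univ = 1 ∧ ∫⁻ x, ‖x‖ₑ ^ p ∂(μ ω) < ∞} with hA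
  have hAm : MeasurableSet A := by
    refine MeasurableSet.inter ?_ ?_
    · exact (μ.measurable_coe MeasurableSet.univ) (measurableSet_singleton _)
    · exact measurableSet_lt ((Measure.measurable_lintegral (by fun_prop)).comp μ.measurable)
        measurable_const
  have hAae : ∀ᵐ ω ∂P, ω ∈ A := by
    have hmeas : Measurable fun ω => ∫⁻ x, ‖x‖ₑ ^ p ∂(μ ω) :=
      (Measure.measurable_lintegral (by fun_prop)).comp μ.measurable
    filter_upwards [hμ.1, ae_lt_top hmeas hμ.2.ne] with ω h1 h2 using ⟨h1.measure_univ, h2⟩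
  -- On the exceptional null set `μ` is replaced by `ν`, so that the moment condition holds for
  -- every `ω`.
  obtain ⟨X, hX, hopt⟩ := exists_measurable_isOptimalMap hp hν hνac
    (Kernel.piecewise hAm μ (Kernel.const Ω ν)) (fun ω => by
      rw [Kernel.piecewise_apply]
      split_ifs with h
      · exact ⟨⟨h.1⟩, h.2⟩
      · rwa [Kernel.const_apply])
  refine ⟨X, hX, ?_⟩
  filter_upwards [hAae] with ω hω
  obtain ⟨h1, h2⟩ := hopt ω
  rw [Kernel.piecewise_apply, if_pos hω] at h1
  have hex : ∃ S, IsOptimalMap p ν (μ ω) S := ⟨_, h1⟩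
  have hom : IsOptimalMap p ν (μ ω) (optMap p ν (μ ω)) := by
    rw [optMap, dif_pos hex]; exact hex.choose_spec
  have huni : ∀ S, IsOptimalMap p ν (μ ω) S → (fun y => X (ω, y)) =ᵐ[ν] S := fun S hS =>
    h1.ae_unique hp hνac hS h2.ne
  exact ⟨hom, fun S hS => (huni S hS).symm.trans (huni _ hom), huni _ hom⟩

end Selection

/-! ### Energy estimates for averages on the interval -/

section SobolevEmbedding

variable {d : ℕ} {T α p : ℝ}

instance : IsFiniteMeasure (leb T) := by
  refine ⟨?_⟩
  rw [leb, comap_subtype_coe_apply measurableSet_Icc, Set.image_univ, Subtype.range_coe]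
  simp

/-- The bound is `r`, not `2r`: near an endpoint half of the ball may be cut off. -/
theorem ofReal_le_leb_closedBall (t : I T) {r : ℝ} (hr : 0 ≤ r) (hrT : r ≤ T) :
    ENNReal.ofReal r ≤ leb T (Metric.closedBall t r) := by
  rw [leb, comap_subtype_coe_apply measurableSet_Icc]
  have himg : Subtype.val '' Metric.closedBall t r
      = Set.Icc (max (t - r : ℝ) 0) (min (t + r : ℝ) T) := by
    ext x
    rw [Set.mem_Icc, max_le_iff, le_min_iff]
    constructor
    · rintro ⟨y, hy, rfl⟩
      rw [Metric.mem_closedBall, Subtype.dist_eq, Real.dist_eq, abs_le] at hy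
      exact ⟨⟨by linarith, y.2.1⟩, by linarith, y.2.2⟩
    · rintro ⟨⟨h1, h2⟩, h3, h4⟩
      refine ⟨⟨x, h2, h4⟩, ?_, rfl⟩
      rw [Metric.mem_closedBall, Subtype.dist_eq, Real.dist_eq, abs_le]
      exact ⟨by linarith, by linarith⟩
  rw [himg, Real.volume_Icc]
  refine ENNReal.ofReal_le_ofReal ?_
  have := t.2.1
  have := t.2.2
  rcases max_cases (t - r : ℝ) 0 with h | h <;> rcases min_cases (t + r : ℝ) T with h' | h' <;>
    rw [h.1, h'.1] <;> linarith

/-- This fails for `T = 0`, where the interval is one point of mass zero; that case is therefore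
treated apart below. -/
theorem leb_isOpenPosMeasure (hT : 0 < T) : (leb T).IsOpenPosMeasure := by
  refine ⟨fun U hU hne h0 => ?_⟩
  obtain ⟨t, ht⟩ := hne
  obtain ⟨r, hr, hrU⟩ := Metric.nhds_basis_closedBall.mem_iff.1 (hU.mem_nhds ht)
  have h1 := ofReal_le_leb_closedBall t (r := min r T) (by positivity) (min_le_right _ _)
  have h2 : leb T (Metric.closedBall t (min r T)) = 0 :=
    measure_mono_null ((Metric.closedBall_subset_closedBall (min_le_left _ _)).trans hrU) h0
  rw [h2, nonpos_iff_eq_zero, ENNReal.ofReal_eq_zero] at h1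
  have : 0 < min r T := by positivity
  linarith

/-- Jensen's inequality for powers. -/
theorem lintegral_rpow_le_of_isProbabilityMeasure {X : Type*} [MeasurableSpace X] {m : Measure X}
    [IsProbabilityMeasure m] (hp : 1 < p) {f : X → ℝ≥0∞} (hf : AEMeasurable f m) :
    (∫⁻ x, f x ∂m) ^ p ≤ ∫⁻ x, f x ^ p ∂m := by
  have h := ENNReal.lintegral_mul_le_Lp_mul_Lq m (Real.HolderConjugate.conjExponent hp) hf
    (aemeasurable_const (b := (1 : ℝ≥0∞)))
  simp only [Pi.mul_apply, mul_one, ENNReal.one_rpow, lintegral_const, measure_univ] at h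
  rwa [← ENNReal.le_rpow_inv_iff (by linarith), ← one_div]

theorem edist_integral_rpow_le {X : Type*} [MeasurableSpace X] {m : Measure X}
    [IsProbabilityMeasure m] (hp : 1 < p) {f : X → E d} (hf : Integrable f m) (c : E d) :
    edist c (∫ x, f x ∂m) ^ p ≤ ∫⁻ x, edist c (f x) ^ p ∂m := by
  refine le_trans (ENNReal.rpow_le_rpow ?_ (by linarith))
    (lintegral_rpow_le_of_isProbabilityMeasure hp (aemeasurable_const.edist hf.aemeasurable))
  have : c - ∫ x, f x ∂m = ∫ x, (c - f x) ∂m := by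
    rw [integral_sub (integrable_const c) hf]; simp
  simp only [edist_eq_enorm_sub]
  rw [this]
  exact enorm_integral_le_lintegral_enorm _

/-- The kernel of the Sobolev energy. -/
noncomputable def sobolevKernel (α p : ℝ) (f : I T → E d) (u v : I T) : ℝ≥0∞ :=
  edist (f u) (f v) ^ p / ENNReal.ofReal (|(v : ℝ) - (u : ℝ)| ^ (1 + α * p))

theorem edist_rpow_le_mul_sobolevKernel (hβ : 0 ≤ 1 + α * p) (f : I T → E d) {u v : I T} {l : ℝ}
    (hl : 0 < l) (huv : dist u v ≤ l) :
    edist (f u) (f v) ^ p ≤ ENNReal.ofReal (l ^ (1 + α * p)) * sobolevKernel α p f u v := by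
  rw [sobolevKernel, mul_comm]
  have hpos : 0 < l ^ (1 + α * p) := Real.rpow_pos_of_pos hl _
  have h1 : edist (f u) (f v) ^ p
      = edist (f u) (f v) ^ p / ENNReal.ofReal (l ^ (1 + α * p))
        * ENNReal.ofReal (l ^ (1 + α * p)) :=
    (ENNReal.div_mul_cancel (by simpa using hpos) ENNReal.ofReal_ne_top).symm
  conv_lhs => rw [h1]
  gcongr
  rw [abs_sub_comm]
  exact huv

theorem lintegral_cond_eq {X : Type*} [MeasurableSpace X] (m : Measure X) (J : Set X)
    (f : X → ℝ≥0∞) : ∫⁻ x, f x ∂m[|J] = (m J)⁻¹ * ∫⁻ x in J, f x ∂m := by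
  rw [ProbabilityTheory.cond, lintegral_smul_measure, smul_eq_mul]

theorem edist_integral_cond_rpow_le (hp : 1 < p) (hβ : 0 ≤ 1 + α * p) {f : I T → E d}
    (hf : Integrable f (leb T)) {J : Set (I T)} (hJ : MeasurableSet J) (hJ0 : leb T J ≠ 0)
    {u : I T} {l : ℝ} (hl : 0 < l) (hJl : ∀ v ∈ J, dist u v ≤ l) :
    edist (f u) (∫ v, f v ∂(leb T)[|J]) ^ p ≤ ENNReal.ofReal (l ^ (1 + α * p))
      * ((leb T J)⁻¹ * ∫⁻ v, sobolevKernel α p f u v ∂(leb T)) := by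
  have := cond_isProbabilityMeasure (μ := leb T) hJ0
  have hint : Integrable f (leb T)[|J] :=
    (hf.restrict (s := J)).smul_measure (ENNReal.inv_ne_top.2 hJ0)
  refine (edist_integral_rpow_le hp hint _).trans ?_
  rw [lintegral_cond_eq, mul_left_comm]
  gcongr
  rw [← lintegral_const_mul' _ _ ENNReal.ofReal_ne_top]
  refine (setLIntegral_mono' hJ fun v hv => ?_).trans (setLIntegral_le_lintegral J _)
  exact edist_rpow_le_mul_sobolevKernel hβ f hl (hJl v hv)

/-- Jensen in both variables. At distance at most `3r` the kernel bound costs `(3r)^(1 + αp)`, and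
each normalization costs `(r/2)⁻¹`; this gives the factor 4 and the exponent `αp - 1`. The sets will
be balls of radius `r` or `r/2`. -/
theorem edist_integral_cond_integral_cond_rpow_le (hp : 1 < p) (hβ : 0 ≤ 1 + α * p)
    {f : I T → E d} (hf : Integrable f (leb T)) {J J' : Set (I T)} (hJ : MeasurableSet J)
    (hJ' : MeasurableSet J') {r : ℝ} (hr : 0 < r) (hJr : ENNReal.ofReal (r / 2) ≤ leb T J)
    (hJr' : ENNReal.ofReal (r / 2) ≤ leb T J') (hJJ' : ∀ u ∈ J, ∀ v ∈ J', dist u v ≤ 3 * r) :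
    edist (∫ v, f v ∂(leb T)[|J]) (∫ v, f v ∂(leb T)[|J']) ^ p ≤
      ENNReal.ofReal (4 * 3 ^ (1 + α * p) * r ^ (α * p - 1))
        * sobolevEnergy α p (fun u v => edist (f u) (f v)) := by
  have hr2 : 0 < ENNReal.ofReal (r / 2) := by simpa using hr
  have hJ0 : leb T J ≠ 0 := (hr2.trans_le hJr).ne'
  have hJ0' : leb T J' ≠ 0 := (hr2.trans_le hJr').ne'
  have := cond_isProbabilityMeasure (μ := leb T) hJ0
  have hint : Integrable f (leb T)[|J] :=
    (hf.restrict (s := J)).smul_measure (ENNReal.inv_ne_top.2 hJ0)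
  rw [edist_comm]
  refine (edist_integral_rpow_le hp hint _).trans ?_
  rw [lintegral_cond_eq]
  have h1 : ∫⁻ u in J, edist (∫ v, f v ∂(leb T)[|J']) (f u) ^ p ∂(leb T) ≤
      ENNReal.ofReal ((3 * r) ^ (1 + α * p)) *
        ((leb T J')⁻¹ * sobolevEnergy α p (fun u v => edist (f u) (f v))) := by
    rw [sobolevEnergy, ← lintegral_const_mul' _ _ (ENNReal.inv_ne_top.2 hJ0'),
      ← lintegral_const_mul' _ _ ENNReal.ofReal_ne_top]
    refine (setLIntegral_mono' hJ fun u hu => ?_).trans (setLIntegral_le_lintegral J _)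
    rw [edist_comm]
    exact edist_integral_cond_rpow_le hp hβ hf hJ' hJ0' (by positivity) (hJJ' u hu)
  have h2 : (leb T J)⁻¹ * (ENNReal.ofReal ((3 * r) ^ (1 + α * p)) * ((leb T J')⁻¹))
      ≤ ENNReal.ofReal (4 * 3 ^ (1 + α * p) * r ^ (α * p - 1)) := by
    have h3 : (4 * 3 ^ (1 + α * p) * r ^ (α * p - 1) : ℝ)
        = (r / 2)⁻¹ * ((3 * r) ^ (1 + α * p) * (r / 2)⁻¹) := by
      rw [Real.mul_rpow (by norm_num) hr.le,
        show 1 + α * p = (α * p - 1) + (2 : ℕ) by push_cast; ring, Real.rpow_add_natCast hr.ne']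
      field_simp
      ring
    rw [h3, ENNReal.ofReal_mul (by positivity), ENNReal.ofReal_mul (by positivity),
      ENNReal.ofReal_inv_of_pos (by positivity)]
    gcongr
  calc (leb T J)⁻¹ * ∫⁻ u in J, edist (∫ v, f v ∂(leb T)[|J']) (f u) ^ p ∂(leb T)
      ≤ (leb T J)⁻¹ * (ENNReal.ofReal ((3 * r) ^ (1 + α * p)) *
        ((leb T J')⁻¹ * sobolevEnergy α p (fun u v => edist (f u) (f v)))) := by gcongr
    _ = ((leb T J)⁻¹ * (ENNReal.ofReal ((3 * r) ^ (1 + α * p)) * ((leb T J')⁻¹)))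
        * sobolevEnergy α p (fun u v => edist (f u) (f v)) := by ring
    _ ≤ _ := by gcongr

theorem ae_lintegral_sobolevKernel_lt_top {f : I T → E d} (hf : Measurable f)
    (hE : sobolevEnergy α p (fun u v => edist (f u) (f v)) < ∞) :
    ∀ᵐ u ∂(leb T), ∫⁻ v, sobolevKernel α p f u v ∂(leb T) < ∞ := by
  have hm : Measurable (Function.uncurry (sobolevKernel α p f)) := by
    unfold sobolevKernel Function.uncurry
    fun_prop
  exact ae_lt_top hm.lintegral_prod_right' hE.ne

/-- By Tonelli some `u` has a finite inner integral; since distances are at most `T`, this bounds `f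
u - f v` in `L^p` in the variable `v`. -/
theorem integrable_of_sobolevEnergy_lt_top (hT : 0 < T) (hp : 1 < p) (hβ : 0 ≤ 1 + α * p)
    {f : I T → E d} (hf : Measurable f)
    (hE : sobolevEnergy α p (fun u v => edist (f u) (f v)) < ∞) : Integrable f (leb T) := by
  have hne : (ae (leb T)).NeBot := by
    have := leb_isOpenPosMeasure hT
    have : Nonempty (I T) := ⟨⟨0, le_rfl, hT.le⟩⟩
    infer_instance
  obtain ⟨u, hu⟩ := (ae_lintegral_sobolevKernel_lt_top hf hE).exists
  have h1 : ∫⁻ v, edist (f u) (f v) ^ p ∂(leb T) < ∞ := by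
    refine lt_of_le_of_lt (lintegral_mono fun v =>
      edist_rpow_le_mul_sobolevKernel hβ f hT (u := u) (v := v) ?_) ?_
    · rw [Subtype.dist_eq, Real.dist_eq, abs_le]
      constructor <;> linarith [u.2.1, u.2.2, v.2.1, v.2.2]
    · rw [lintegral_const_mul' _ _ ENNReal.ofReal_ne_top]
      exact ENNReal.mul_lt_top ENNReal.ofReal_lt_top hu
  have h2 : MemLp (fun v => f u - f v) (ENNReal.ofReal p) (leb T) := by
    refine ⟨(measurable_const.sub hf).aestronglyMeasurable, ?_⟩
    rw [eLpNorm_lt_top_iff_lintegral_rpow_enorm_lt_top (by simpa using by linarith)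
      ENNReal.ofReal_ne_top, ENNReal.toReal_ofReal (by linarith)]
    simpa only [edist_eq_enorm_sub] using h1
  have h3 : Integrable (fun v => f u - f v) (leb T) :=
    h2.integrable (by rw [← ENNReal.ofReal_one]; exact ENNReal.ofReal_le_ofReal hp.le)
  refine ((integrable_const (f u)).sub h3).congr (ae_of_all _ fun v => ?_)
  simp

end SobolevEmbedding

/-! ### Dyadic averages and the continuous version -/

section SobolevEmbedding

variable {d : ℕ} {T α p : ℝ}

/-- The average of `f` over the closed ball of radius `T / 2 ^ n`. -/
noncomputable def dyadicAverage (f : I T → E d) (n : ℕ) (t : I T) : E d :=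
  ∫ u, f u ∂(leb T)[|Metric.closedBall t (T * (1 / 2) ^ n)]

theorem ofReal_le_leb_dyadicBall (hT : 0 < T) (n : ℕ) (t : I T) :
    ENNReal.ofReal (T * (1 / 2) ^ n) ≤ leb T (Metric.closedBall t (T * (1 / 2) ^ n)) :=
  ofReal_le_leb_closedBall t (by positivity)
    (mul_le_of_le_one_right hT.le (pow_le_one₀ (by norm_num) (by norm_num)))

/-- Recovers each value of a continuous version from the almost everywhere class of the curve, which
later gives measurability in `ω`. -/
theorem tendsto_dyadicAverage_of_continuous (hT : 0 < T) {g : I T → E d} (hg : Continuous g)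
    (t : I T) : Tendsto (fun n => dyadicAverage g n t) atTop (𝓝 (g t)) := by
  rw [Metric.tendsto_atTop]
  intro ε hε
  obtain ⟨δ, hδ, hball⟩ := Metric.continuousAt_iff.1 hg.continuousAt (ε / 2) (half_pos hε)
  have hlim : Tendsto (fun n : ℕ => T * (1 / 2 : ℝ) ^ n) atTop (𝓝 0) := by
    simpa using (tendsto_pow_atTop_nhds_zero_of_lt_one (r := (1 / 2 : ℝ)) (by norm_num)
      (by norm_num)).const_mul T
  obtain ⟨N, hN⟩ := eventually_atTop.1 (hlim.eventually_lt_const hδ)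
  refine ⟨N, fun n hn => lt_of_le_of_lt ?_ (half_lt_self hε)⟩
  have hne : leb T (Metric.closedBall t (T * (1 / 2) ^ n)) ≠ 0 :=
    (lt_of_lt_of_le (by simpa using hT) (ofReal_le_leb_dyadicBall hT n t)).ne'
  have := cond_isProbabilityMeasure (μ := leb T) hne
  have hae : ∀ᵐ u ∂(leb T)[|Metric.closedBall t (T * (1 / 2) ^ n)], ‖g u - g t‖ ≤ ε / 2 := by
    refine ae_cond_of_forall_mem Metric.isClosed_closedBall.measurableSet fun u hu => ?_
    rw [← dist_eq_norm]
    exact (hball (lt_of_le_of_lt (Metric.mem_closedBall.1 hu) (hN n hn))).le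
  have hint : Integrable g (leb T)[|Metric.closedBall t (T * (1 / 2) ^ n)] :=
    (BoundedContinuousFunction.mkOfCompact ⟨g, hg⟩).integrable _
  have h1 : dyadicAverage g n t - g t
      = ∫ u, (g u - g t) ∂(leb T)[|Metric.closedBall t (T * (1 / 2) ^ n)] := by
    rw [integral_sub hint (integrable_const _), integral_const, probReal_univ, one_smul]
    rfl
  have h2 := norm_integral_le_of_norm_le_const hae
  rw [probReal_univ, mul_one] at h2
  rwa [dist_eq_norm, h1]

theorem dyadicAverage_congr {f g : I T → E d} (h : f =ᵐ[leb T] g) (n : ℕ) (t : I T) :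
    dyadicAverage f n t = dyadicAverage g n t :=
  integral_congr_ae (cond_absolutelyContinuous.ae_le h)

/-- **Fractional Sobolev embedding**: a measurable curve of finite `W^{α,p}` energy, `α p > 1`, has
a continuous version, which is Hölder continuous. -/
theorem exists_continuous_version (hT : 0 < T) (hp : 1 < p) (hαp : 1 < α * p) :
    ∃ C : ℝ≥0∞, C ≠ ∞ ∧ ∀ f : I T → E d, Measurable f →
      sobolevEnergy α p (fun u v => edist (f u) (f v)) < ∞ →
      ∃ g : Paths T d, f =ᵐ[leb T] g ∧ ∀ s t, edist (g s) (g t) ^ p ≤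
        C * ENNReal.ofReal (dist s t ^ (α * p - 1))
          * sobolevEnergy α p (fun u v => edist (f u) (f v)) := by
  have hp0 : 0 < p := by linarith
  have hβ : 0 ≤ 1 + α * p := by linarith
  set γ : ℝ := α * p - 1 with hγ
  have hγ0 : 0 < γ := by linarith
  set q' : ℝ := (1 / 2) ^ γ with hq'
  have hq'0 : 0 < q' := by positivity
  have hq'1 : q' < 1 := Real.rpow_lt_one (by norm_num) (by norm_num) hγ0
  -- Halving the radius multiplies the distance bound `M n` by `q = 2^(-(α - 1/p))`, and `αp > 1`
  -- makes it less than 1.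
  set q : ℝ≥0∞ := ENNReal.ofReal q' ^ (1 / p) with hq
  have hq1 : q < 1 := ENNReal.rpow_lt_one (by rw [ENNReal.ofReal_lt_one]; exact hq'1)
    (by positivity)
  set K : ℝ := 4 * 3 ^ (1 + α * p) with hK
  have hK0 : 0 < K := by positivity
  -- Two geometric tails, from `g s` and `g t` to their averages, and one comparison of averages at
  -- a common scale.
  set c : ℝ≥0∞ := (1 - q)⁻¹ + 1 + (1 - q)⁻¹ with hc
  have hq1' : (1 - q)⁻¹ ≠ ∞ := ENNReal.inv_ne_top.2 (tsub_pos_of_lt hq1).ne'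
  have hcfin : c ≠ ∞ := by simp [hc, hq1']
  refine ⟨c ^ p * ENNReal.ofReal (K * 2 ^ γ), ENNReal.mul_ne_top
    (ENNReal.rpow_ne_top_of_nonneg hp0.le hcfin) ENNReal.ofReal_ne_top, fun f hf hE => ?_⟩
  set B := sobolevEnergy α p (fun u v => edist (f u) (f v)) with hB
  have hint := integrable_of_sobolevEnergy_lt_top hT hp hβ hf hE
  set r : ℕ → ℝ := fun n => T * (1 / 2) ^ n with hr
  have hr0 : ∀ n, 0 < r n := fun n => by positivity
  have hrs : ∀ n, r (n + 1) = r n / 2 := fun n => by simp only [hr, pow_succ]; ring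
  have hball : ∀ n t, ENNReal.ofReal (r n / 2) ≤ leb T (Metric.closedBall t (r n)) := fun n t =>
    (ENNReal.ofReal_le_ofReal (by linarith [hr0 n])).trans (ofReal_le_leb_dyadicBall hT n t)
  set M : ℕ → ℝ≥0∞ := fun n => (ENNReal.ofReal (K * r n ^ γ) * B) ^ (1 / p) with hM
  have hrow : ∀ {x : ℝ≥0∞} {n : ℕ}, x ^ p ≤ ENNReal.ofReal (K * r n ^ γ) * B → x ≤ M n := by
    intro x n hx
    rw [hM]
    dsimp only
    rwa [one_div, ENNReal.le_rpow_inv_iff hp0]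
  have hMq : ∀ n, M n = M 0 * q ^ n := by
    intro n
    have h1 : K * r n ^ γ = K * r 0 ^ γ * q' ^ n := by
      simp only [hr, hq', pow_zero, mul_one]
      rw [Real.mul_rpow hT.le (by positivity), ← Real.rpow_natCast, ← Real.rpow_natCast,
        ← Real.rpow_mul (by norm_num), ← Real.rpow_mul (by norm_num), mul_comm (n : ℝ) γ]
      ring
    simp only [hM]
    rw [h1, ENNReal.ofReal_mul (by have := hr0 0; positivity), mul_right_comm,
      ENNReal.mul_rpow_of_nonneg _ _ (by positivity), ENNReal.ofReal_pow hq'0.le, hq,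
      ← ENNReal.rpow_natCast, ← ENNReal.rpow_natCast, ← ENNReal.rpow_mul, ← ENNReal.rpow_mul,
      mul_comm (1 / p)]
  have hM0 : ∀ n, M n ≠ ∞ := fun n => ENNReal.rpow_ne_top_of_nonneg (by positivity)
    (ENNReal.mul_ne_top ENNReal.ofReal_ne_top hE.ne)
  have hmeas : ∀ (t : I T) (n : ℕ), MeasurableSet (Metric.closedBall t (r n)) := fun t n =>
    Metric.isClosed_closedBall.measurableSet
  have hsucc : ∀ t n, edist (dyadicAverage f n t) (dyadicAverage f (n + 1) t) ≤ M n := by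
    intro t n
    refine hrow (edist_integral_cond_integral_cond_rpow_le hp hβ hint (hmeas t n)
      (hmeas t (n + 1)) (hr0 n) (hball n t) ?_ ?_)
    · rw [← hrs]; exact ofReal_le_leb_dyadicBall hT (n + 1) t
    · intro u hu v hv
      rw [Metric.mem_closedBall] at hu hv
      rw [hrs] at hv
      have := dist_triangle_right u v t
      linarith [hr0 n]
  have hnear : ∀ s t n, dist s t ≤ r n →
      edist (dyadicAverage f n s) (dyadicAverage f n t) ≤ M n := by
    intro s t n hst
    refine hrow (edist_integral_cond_integral_cond_rpow_le hp hβ hint (hmeas s n)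
      (hmeas t n) (hr0 n) (hball n s) (hball n t) ?_)
    intro u hu v hv
    rw [Metric.mem_closedBall] at hu hv
    have h1 := dist_triangle4 u s t v
    rw [dist_comm t v] at h1
    linarith
  have hcau : ∀ t, ∃ x, Tendsto (fun n => dyadicAverage f n t) atTop (𝓝 x) := fun t =>
    cauchySeq_tendsto_of_complete (cauchySeq_of_edist_le_geometric q (M 0) hq1 (hM0 0)
      fun n => (hsucc t n).trans_eq (hMq n))
  choose g hg using hcau
  have hdist : ∀ t n, edist (dyadicAverage f n t) (g t) ≤ M n * (1 - q)⁻¹ := by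
    intro t n
    rw [hMq n, ← div_eq_mul_inv]
    exact edist_le_of_edist_le_geometric_of_tendsto q (M 0)
      (fun n => (hsucc t n).trans_eq (hMq n)) (hg t) n
  have hhold : ∀ s t, edist (g s) (g t) ^ p ≤
      c ^ p * ENNReal.ofReal (K * 2 ^ γ) * ENNReal.ofReal (dist s t ^ γ) * B := by
    intro s t
    rcases eq_or_ne s t with rfl | hst
    · rw [edist_self, ENNReal.zero_rpow_of_pos hp0]; exact zero_le
    have hst0 : 0 < dist s t := dist_pos.2 hst
    have hstT : dist s t / T ≤ 1 := by
      rw [div_le_one hT, Subtype.dist_eq, Real.dist_eq, abs_le]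
      constructor <;> linarith [s.2.1, s.2.2, t.2.1, t.2.2]
    -- The scale with `r (n + 1) < dist s t ≤ r n`; the factor `2 ^ γ` comes from `r n < 2 * dist s
    -- t`.
    obtain ⟨n, hn1, hn2⟩ := exists_nat_pow_near_of_lt_one (div_pos hst0 hT) hstT
      (by norm_num : (0 : ℝ) < 1 / 2) (by norm_num)
    rw [lt_div_iff₀ hT, mul_comm] at hn1
    rw [div_le_iff₀ hT, mul_comm] at hn2
    have h1 : edist (g s) (g t) ≤ c * M n := by
      calc edist (g s) (g t) ≤ edist (g s) (dyadicAverage f n s)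
            + edist (dyadicAverage f n s) (dyadicAverage f n t)
            + edist (dyadicAverage f n t) (g t) := edist_triangle4 _ _ _ _
        _ ≤ M n * (1 - q)⁻¹ + M n + M n * (1 - q)⁻¹ := by
            gcongr
            · rw [edist_comm]; exact hdist s n
            · exact hnear s t n hn2
            · exact hdist t n
        _ = c * M n := by rw [hc]; ring
    calc edist (g s) (g t) ^ p ≤ (c * M n) ^ p := ENNReal.rpow_le_rpow h1 hp0.le
      _ = c ^ p * (ENNReal.ofReal (K * r n ^ γ) * B) := by
          rw [ENNReal.mul_rpow_of_nonneg _ _ hp0.le, hM]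
          dsimp only
          rw [← ENNReal.rpow_mul, one_div_mul_cancel hp0.ne', ENNReal.rpow_one]
      _ ≤ c ^ p * (ENNReal.ofReal (K * 2 ^ γ * dist s t ^ γ) * B) := by
          have h2 : r n ^ γ ≤ (2 * dist s t) ^ γ := by
            refine Real.rpow_le_rpow (hr0 n).le ?_ hγ0.le
            have : T * (1 / 2) ^ (n + 1) = r n / 2 := hrs n
            linarith
          rw [Real.mul_rpow (by norm_num) hst0.le] at h2
          have h3 : K * r n ^ γ ≤ K * 2 ^ γ * dist s t ^ γ := by
            rw [mul_assoc K]
            exact mul_le_mul_of_nonneg_left h2 hK0.le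
          exact mul_le_mul' le_rfl (mul_le_mul' (ENNReal.ofReal_le_ofReal h3) le_rfl)
      _ = _ := by
          rw [ENNReal.ofReal_mul (by positivity)]; ring
  have hgc : Continuous g := by
    rw [continuous_iff_continuousAt]
    intro t
    rw [ContinuousAt, tendsto_iff_edist_tendsto_0]
    have h1 : Tendsto (fun s : I T => (c ^ p * ENNReal.ofReal (K * 2 ^ γ) *
        ENNReal.ofReal (dist s t ^ γ) * B) ^ (1 / p)) (𝓝 t) (𝓝 0) := by
      have h2 : Tendsto (fun s : I T => ENNReal.ofReal (dist s t ^ γ)) (𝓝 t) (𝓝 0) := by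
        have h3 : Continuous fun s : I T => ENNReal.ofReal (dist s t ^ γ) :=
          ENNReal.continuous_ofReal.comp
            ((continuous_id.dist continuous_const).rpow_const fun _ => Or.inr hγ0.le)
        simpa [Real.zero_rpow hγ0.ne'] using h3.tendsto t
      have h4 := ENNReal.Tendsto.mul_const (ENNReal.Tendsto.const_mul h2
        (a := c ^ p * ENNReal.ofReal (K * 2 ^ γ)) (Or.inr (ENNReal.mul_ne_top
          (ENNReal.rpow_ne_top_of_nonneg hp0.le hcfin) ENNReal.ofReal_ne_top)))
          (b := B) (Or.inr hE.ne)
      rw [mul_zero, zero_mul] at h4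
      have h5 := (ENNReal.continuous_rpow_const (y := 1 / p)).tendsto 0
      rw [ENNReal.zero_rpow_of_pos (by positivity)] at h5
      exact h5.comp h4
    refine tendsto_of_tendsto_of_tendsto_of_le_of_le tendsto_const_nhds h1
      (fun _ => zero_le) fun s => ?_
    rw [one_div]
    exact (ENNReal.le_rpow_inv_iff hp0).2 (hhold s t)
  refine ⟨⟨g, hgc⟩, ?_, hhold⟩
  filter_upwards [ae_lintegral_sobolevKernel_lt_top hf hE] with t ht
  -- Where the inner energy integral is finite, averages over balls of radius `r` are within its
  -- product with `r^(αp)`, in `p`-th power, of `f t`; hence the limit `g` is `f` almost everywhere.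
  have hlim : Tendsto (fun n => dyadicAverage f n t) atTop (𝓝 (f t)) := by
    rw [tendsto_iff_edist_tendsto_0]
    have hb : ∀ n, edist (dyadicAverage f n t) (f t) ≤
        (ENNReal.ofReal (r n ^ (α * p)) * ∫⁻ v, sobolevKernel α p f t v ∂(leb T)) ^ (1 / p) := by
      intro n
      rw [one_div, ENNReal.le_rpow_inv_iff hp0, edist_comm]
      have hJ0 : leb T (Metric.closedBall t (r n)) ≠ 0 :=
        (lt_of_lt_of_le (ENNReal.ofReal_pos.2 (hr0 n)) (ofReal_le_leb_dyadicBall hT n t)).ne'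
      refine (edist_integral_cond_rpow_le hp hβ hint (hmeas t n) hJ0 (hr0 n)
        fun v hv => by rw [dist_comm]; exact hv).trans ?_
      rw [← mul_assoc]
      gcongr
      have h3 : r n ^ (α * p) = r n ^ (1 + α * p) * (r n)⁻¹ := by
        rw [Real.rpow_one_add' (hr0 n).le (by linarith), mul_comm (r n),
          mul_inv_cancel_right₀ (hr0 n).ne']
      rw [h3, ENNReal.ofReal_mul (by have := hr0 n; positivity),
        ENNReal.ofReal_inv_of_pos (hr0 n)]
      gcongr
      exact ofReal_le_leb_dyadicBall hT n t
    have hz : Tendsto (fun n => (ENNReal.ofReal (r n ^ (α * p)) *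
        ∫⁻ v, sobolevKernel α p f t v ∂(leb T)) ^ (1 / p)) atTop (𝓝 0) := by
      have hr1 : Tendsto r atTop (𝓝 0) := by
        simpa [hr] using (tendsto_pow_atTop_nhds_zero_of_lt_one (r := (1 / 2 : ℝ)) (by norm_num)
          (by norm_num)).const_mul T
      have hr2 : Tendsto (fun n => ENNReal.ofReal (r n ^ (α * p))) atTop (𝓝 0) := by
        have h5 : Continuous fun x : ℝ => ENNReal.ofReal (x ^ (α * p)) :=
          ENNReal.continuous_ofReal.comp (Real.continuous_rpow_const (by linarith))
        have h6 : Tendsto (fun n => ENNReal.ofReal (r n ^ (α * p))) atTop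
          (𝓝 (ENNReal.ofReal (0 ^ (α * p)))) := (h5.tendsto 0).comp hr1
        rwa [Real.zero_rpow (show α * p ≠ 0 by linarith), ENNReal.ofReal_zero] at h6
      have h4 := ENNReal.Tendsto.mul_const hr2
        (b := ∫⁻ v, sobolevKernel α p f t v ∂(leb T)) (Or.inr ht.ne)
      rw [zero_mul] at h4
      have h5 := (ENNReal.continuous_rpow_const (y := 1 / p)).tendsto 0
      rw [ENNReal.zero_rpow_of_pos (by positivity)] at h5
      exact h5.comp h4
    exact tendsto_of_tendsto_of_tendsto_of_le_of_le tendsto_const_nhds hz (fun _ => zero_le) hb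
  exact tendsto_nhds_unique hlim (hg t)

/-- Paths of finite `W^{α,p}` energy, `α p > 1`, are Hölder continuous. -/
theorem exists_edist_rpow_le_pathEnergy (hT : 0 ≤ T) (hp : 1 < p) (hαp : 1 < α * p) :
    ∃ C : ℝ≥0∞, C ≠ ∞ ∧ ∀ g : Paths T d, pathEnergy α p g < ∞ → ∀ s t,
      edist (g s) (g t) ^ p ≤ C * ENNReal.ofReal (dist s t ^ (α * p - 1)) * pathEnergy α p g := by
  rcases hT.eq_or_lt with rfl | hT
  · refine ⟨0, ENNReal.zero_ne_top, fun g _ s t => ?_⟩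
    have hst : s = t := Subsingleton.elim s t
    rw [hst, edist_self, ENNReal.zero_rpow_of_pos (by linarith)]
    exact zero_le
  · obtain ⟨C, hC, h⟩ := exists_continuous_version (d := d) hT hp hαp
    refine ⟨C, hC, fun g hg s t => ?_⟩
    obtain ⟨g', hg', hle⟩ := h g g.continuous.measurable hg
    have := leb_isOpenPosMeasure hT
    have heq : (g : I T → E d) = g' := (g.continuous.ae_eq_iff_eq (leb T) g'.continuous).1 hg'
    rw [heq]
    exact hle s t

end SobolevEmbedding

/-! ### Continuous modification of an `L^p` process -/

section Modification

variable {d : ℕ} {T α p : ℝ} {Ω' : Type*} [MeasurableSpace Ω']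

/-- A map into the path space is measurable as soon as its evaluations are. -/
theorem measurable_paths {Y : Ω' → Paths T d} (h : ∀ t, Measurable fun ω => Y ω t) :
    Measurable Y := by
  rcases isEmpty_or_nonempty (I T) with hI | hI
  · have : Subsingleton (Paths T d) := ⟨fun f g => ContinuousMap.ext fun t => hI.elim t⟩
    exact measurable_of_subsingleton_codomain Y
  · let ι : Paths T d → ℕ → E d := fun g n => g (TopologicalSpace.denseSeq (I T) n)
    have hι : Continuous ι := continuous_pi fun n => ContinuousEvalConst.continuous_eval_const _
    have hinj : Function.Injective ι := fun f g hfg => ContinuousMap.ext fun t => congrFun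
      ((TopologicalSpace.denseRange_denseSeq (I T)).equalizer f.continuous g.continuous hfg) t
    -- Lusin–Souslin: a continuous injection of the Polish path space is a measurable embedding.
    refine (hι.measurableEmbedding hinj).measurable_comp_iff.1 ?_
    exact measurable_pi_lambda _ fun n => h _

/-- An `L^p`-continuous process is approximated by jointly measurable ones. -/
theorem exists_measurable_approx {Q : Measure Ω'} {X : I T → Ω' → E d} (hX : ∀ t, Measurable (X t))
    (hcont : ∀ t, Tendsto (fun s => ∫⁻ ω, edist (X s ω) (X t ω) ^ p ∂Q) (𝓝 t) (𝓝 0))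
    {ε : ℝ≥0∞} (hε : 0 < ε) :
    ∃ Z : I T × Ω' → E d, Measurable Z ∧
      ∀ t, ∫⁻ ω, edist (X t ω) (Z (t, ω)) ^ p ∂Q ≤ ε := by
  classical
  rcases isEmpty_or_nonempty (I T) with hI | hI
  · exact ⟨fun _ => 0, measurable_const, fun t => hI.elim t⟩
  have hU : ∀ c : I T, interior {s | ∫⁻ ω, edist (X s ω) (X c ω) ^ p ∂Q ≤ ε} ∈ 𝓝 c := fun c =>
    interior_mem_nhds.2 ((hcont c).eventually_le_const hε)
  obtain ⟨S, hSc, hScov⟩ := TopologicalSpace.countable_cover_nhds hU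
  have hSne : S.Nonempty := by
    obtain ⟨t⟩ := hI
    obtain ⟨c, hc, -⟩ := Set.mem_iUnion₂.1 (hScov ▸ Set.mem_univ t)
    exact ⟨c, hc⟩
  obtain ⟨c, rfl⟩ := hSc.exists_eq_range hSne
  have hex : ∀ z : I T × Ω', ∃ n,
      z.1 ∈ interior {s | ∫⁻ ω, edist (X s ω) (X (c n) ω) ^ p ∂Q ≤ ε} := by
    intro z
    obtain ⟨_, ⟨n, rfl⟩, hn⟩ := Set.mem_iUnion₂.1 (hScov ▸ Set.mem_univ z.1)
    exact ⟨n, hn⟩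
  -- Freeze the process at the first center, in a countable cover of the interval, whose
  -- neighborhood contains `t`; the index depends on `t` only.
  refine ⟨fun z => X (c (Nat.find (hex z))) z.2, ?_, fun t => ?_⟩
  · exact Measurable.find (f := fun n z => X (c n) z.2) (fun n => by fun_prop)
      (fun n => isOpen_interior.measurableSet.preimage measurable_fst) hex
  · have hfind : ∀ ω, Nat.find (hex (t, ω)) = Nat.find (p := fun n =>
        t ∈ interior {s | ∫⁻ ω, edist (X s ω) (X (c n) ω) ^ p ∂Q ≤ ε})
        (by obtain ⟨_, ⟨n, rfl⟩, hn⟩ := Set.mem_iUnion₂.1 (hScov ▸ Set.mem_univ t)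
            exact ⟨n, hn⟩) := fun ω => rfl
    simp only [hfind]
    have hspec := Nat.find_spec (p := fun n =>
        t ∈ interior {s | ∫⁻ ω, edist (X s ω) (X (c n) ω) ^ p ∂Q ≤ ε})
        (by obtain ⟨_, ⟨n, rfl⟩, hn⟩ := Set.mem_iUnion₂.1 (hScov ▸ Set.mem_univ t)
            exact ⟨n, hn⟩)
    have := interior_subset hspec
    exact this

variable (Q : Measure Ω') [IsProbabilityMeasure Q]

theorem lintegral_lintegral_lintegral_rotate {A B : Type*} [MeasurableSpace A] [MeasurableSpace B]
    (m : Measure A) [SFinite m] (n : Measure B) [SFinite n] {F : A × B × B → ℝ≥0∞}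
    (hF : Measurable F) :
    ∫⁻ a, ∫⁻ u, ∫⁻ v, F (a, u, v) ∂n ∂n ∂m = ∫⁻ u, ∫⁻ v, ∫⁻ a, F (a, u, v) ∂m ∂n ∂n := by
  have h1 : Measurable fun z : A × B => ∫⁻ v, F (z.1, z.2, v) ∂n :=
    Measurable.lintegral_prod_right' (f := fun z : (A × B) × B => F (z.1.1, z.1.2, z.2))
      (by fun_prop)
  rw [lintegral_lintegral_swap (f := fun a u => ∫⁻ v, F (a, u, v) ∂n) h1.aemeasurable]
  refine lintegral_congr fun u => ?_
  have h2 : Measurable fun z : A × B => F (z.1, u, z.2) := by fun_prop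
  exact lintegral_lintegral_swap (f := fun a v => F (a, u, v)) h2.aemeasurable

theorem measurable_energyDensity {Z : I T × Ω' → E d} (hZ : Measurable Z) (α p : ℝ) :
    Measurable fun z : Ω' × I T × I T => edist (Z (z.2.1, z.1)) (Z (z.2.2, z.1)) ^ p /
      ENNReal.ofReal (|(z.2.2 : ℝ) - (z.2.1 : ℝ)| ^ (1 + α * p)) := by
  fun_prop

theorem measurable_sobolevEnergy {Z : I T × Ω' → E d} (hZ : Measurable Z) (α p : ℝ) :
    Measurable fun ω => sobolevEnergy α p (fun u v => edist (Z (u, ω)) (Z (v, ω))) := by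
  refine Measurable.lintegral_prod_right' (f := fun z : Ω' × I T => ∫⁻ v,
    edist (Z (z.2, z.1)) (Z (v, z.1)) ^ p /
      ENNReal.ofReal (|(v : ℝ) - (z.2 : ℝ)| ^ (1 + α * p)) ∂(leb T)) ?_
  exact Measurable.lintegral_prod_right' (f := fun z : (Ω' × I T) × I T =>
    edist (Z (z.1.2, z.1.1)) (Z (z.2, z.1.1)) ^ p /
      ENNReal.ofReal (|(z.2 : ℝ) - (z.1.2 : ℝ)| ^ (1 + α * p)))
    (by fun_prop)

/-- The expected energy of a measurable process. -/
theorem lintegral_sobolevEnergy_eq {Z : I T × Ω' → E d} (hZ : Measurable Z) :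
    ∫⁻ ω, sobolevEnergy α p (fun u v => edist (Z (u, ω)) (Z (v, ω))) ∂Q =
      ∫⁻ u, ∫⁻ v, (∫⁻ ω, edist (Z (u, ω)) (Z (v, ω)) ^ p ∂Q) /
        ENNReal.ofReal (|(v : ℝ) - (u : ℝ)| ^ (1 + α * p)) ∂(leb T) ∂(leb T) := by
  refine (lintegral_lintegral_lintegral_rotate Q (leb T)
    (measurable_energyDensity hZ α p)).trans ?_
  refine lintegral_congr fun u => lintegral_congr fun v => ?_
  simp only [div_eq_mul_inv]
  exact lintegral_mul_const _ (by fun_prop)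

variable {Q}

theorem tendsto_edist_of_tendsto_rpow (hp : 0 < p) {ι : Type*} {l : Filter ι} {f : ι → ℝ≥0∞}
    (h : Tendsto (fun i => f i ^ p) l (𝓝 0)) : Tendsto f l (𝓝 0) := by
  have h5 := (ENNReal.continuous_rpow_const (y := 1 / p)).tendsto 0
  rw [ENNReal.zero_rpow_of_pos (by positivity)] at h5
  refine (h5.comp h).congr fun i => ?_
  rw [Function.comp_apply, ← ENNReal.rpow_mul, mul_one_div_cancel hp.ne', ENNReal.rpow_one]

/-- An `L^p`-continuous process has a jointly measurable version. -/
theorem exists_measurable_version (hp : 0 < p) {X : I T → Ω' → E d} (hX : ∀ t, Measurable (X t))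
    (hcont : ∀ t, Tendsto (fun s => ∫⁻ ω, edist (X s ω) (X t ω) ^ p ∂Q) (𝓝 t) (𝓝 0)) :
    ∃ Z : I T × Ω' → E d, Measurable Z ∧
      ∀ᵐ t ∂(leb T), ∀ᵐ ω ∂Q, Z (t, ω) = X t ω := by
  have hεpos : ∀ k : ℕ, 0 < (2⁻¹ : ℝ≥0∞) ^ k := fun k => by
    exact ENNReal.pow_pos (by simp) k
  choose Z hZ hZX using fun k : ℕ => exists_measurable_approx (Q := Q) hX hcont (hεpos k)
  -- The errors `2^(-k)` are summable, so the approximations converge almost surely for every `t`,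
  -- with no subsequence.
  have hlim : ∀ t, ∀ᵐ ω ∂Q, Tendsto (fun k => Z k (t, ω)) atTop (𝓝 (X t ω)) := by
    intro t
    have hmeas : ∀ k, Measurable fun ω => edist (X t ω) (Z k (t, ω)) ^ p := fun k =>
      ((hX t).edist ((hZ k).comp (by fun_prop))).pow_const p
    have hsum : ∫⁻ ω, ∑' k, edist (X t ω) (Z k (t, ω)) ^ p ∂Q ≠ ∞ := by
      rw [lintegral_tsum fun k => (hmeas k).aemeasurable]
      refine ne_top_of_le_ne_top ?_ (ENNReal.tsum_le_tsum fun k => hZX k t)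
      rw [ENNReal.tsum_geometric]
      simp
    filter_upwards [ae_lt_top (Measurable.tsum fun k => hmeas k) hsum] with ω hω
    rw [tendsto_iff_edist_tendsto_0]
    simp only [edist_comm _ (X t ω)]
    exact tendsto_edist_of_tendsto_rpow hp (ENNReal.tendsto_atTop_zero_of_tsum_ne_top hω.ne)
  have hex : ∀ᵐ z ∂((leb T).prod Q), ∃ l, Tendsto (fun k => Z k z) atTop (𝓝 l) := by
    rw [Measure.ae_prod_iff_ae_ae (measurableSet_exists_tendsto hZ)]
    refine ae_of_all _ fun t => ?_
    filter_upwards [hlim t] with ω hω using ⟨_, hω⟩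
  obtain ⟨Z', hZ', hZZ'⟩ := measurable_limit_of_tendsto_metrizable_ae
    (fun k => (hZ k).aemeasurable) hex
  refine ⟨Z', hZ', ?_⟩
  filter_upwards [Measure.ae_ae_of_ae_prod hZZ'] with t ht
  filter_upwards [ht, hlim t] with ω h1 h2 using tendsto_nhds_unique h1 h2

/-- A process which is continuous in `L^p` and has finite `W^{α,p}` energy in `L^p`, `α p > 1`, has
a modification with continuous paths. -/
theorem exists_continuous_modification (hT : 0 ≤ T) (hp : 1 < p) (hαp : 1 < α * p)
    {X : I T → Ω' → E d} (hX : ∀ t, Measurable (X t))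
    (hcont : ∀ t, Tendsto (fun s => ∫⁻ ω, edist (X s ω) (X t ω) ^ p ∂Q) (𝓝 t) (𝓝 0))
    (hE : ∫⁻ u, ∫⁻ v, (∫⁻ ω, edist (X u ω) (X v ω) ^ p ∂Q) /
        ENNReal.ofReal (|(v : ℝ) - (u : ℝ)| ^ (1 + α * p)) ∂(leb T) ∂(leb T) < ∞) :
    ∃ Y : Ω' → Paths T d, Measurable Y ∧ ∀ t, ∀ᵐ ω ∂Q, Y ω t = X t ω := by
  classical
  have hp0 : 0 < p := by linarith
  rcases hT.eq_or_lt with rfl | hT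
  · let t₀ : I 0 := ⟨0, le_rfl, le_rfl⟩
    refine ⟨fun ω => ContinuousMap.const _ (X t₀ ω), measurable_paths fun t => ?_, fun t => ?_⟩
    · exact hX t₀
    · refine ae_of_all _ fun ω => ?_
      rw [Subsingleton.elim t t₀]
      rfl
  obtain ⟨Z, hZ, hZX⟩ := exists_measurable_version hp0 hX hcont
  have hZE : ∫⁻ ω, sobolevEnergy α p (fun u v => edist (Z (u, ω)) (Z (v, ω))) ∂Q < ∞ := by
    rw [lintegral_sobolevEnergy_eq Q hZ]
    refine lt_of_le_of_lt (le_of_eq ?_) hE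
    refine lintegral_congr_ae ?_
    filter_upwards [hZX] with u hu
    refine lintegral_congr_ae ?_
    filter_upwards [hZX] with v hv
    congr 1
    refine lintegral_congr_ae ?_
    filter_upwards [hu, hv] with ω h1 h2
    rw [h1, h2]
  have hEm := measurable_sobolevEnergy hZ α p
  set A : Set Ω' := {ω | sobolevEnergy α p (fun u v => edist (Z (u, ω)) (Z (v, ω))) < ∞} with hA
  have hAm : MeasurableSet A := measurableSet_lt hEm measurable_const
  have hAae : ∀ᵐ ω ∂Q, ω ∈ A := ae_lt_top hEm hZE.ne
  obtain ⟨C, -, hC⟩ := exists_continuous_version (d := d) hT hp hαp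
  have hg : ∀ ω, ∃ g : Paths T d, (ω ∈ A → (fun t => Z (t, ω)) =ᵐ[leb T] g) ∧
      -- A fixed value on the null set where the energy is infinite, so that `Y` is measurable
      -- everywhere.
      (ω ∉ A → g = 0) := by
    intro ω
    by_cases hω : ω ∈ A
    · obtain ⟨g, hg, -⟩ := hC (fun t => Z (t, ω)) (hZ.comp (by fun_prop)) hω
      exact ⟨g, fun _ => hg, fun h => absurd hω h⟩
    · exact ⟨0, fun h => absurd h hω, fun _ => rfl⟩
  choose Y hYZ hY0 using hg
  have hYm : Measurable Y := by
    refine measurable_paths fun t => ?_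
    refine measurable_of_tendsto_metrizable (f := fun (n : ℕ) ω =>
      if ω ∈ A then dyadicAverage (fun t => Z (t, ω)) n t else 0) (fun n => ?_)
      (tendsto_pi_nhds.2 fun ω => ?_)
    · exact Measurable.ite hAm
        (StronglyMeasurable.integral_prod_left' hZ.stronglyMeasurable).measurable measurable_const
    · by_cases hω : ω ∈ A
      · simp only [if_pos hω, dyadicAverage_congr (hYZ ω hω)]
        exact tendsto_dyadicAverage_of_continuous hT (Y ω).continuous t
      · simp only [if_neg hω, hY0 ω hω]
        exact tendsto_const_nhds
  have hYX : ∀ᵐ t ∂(leb T), ∀ᵐ ω ∂Q, Y ω t = X t ω := by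
    have h1 : ∀ᵐ ω ∂Q, ∀ᵐ t ∂(leb T), Z (t, ω) = Y ω t := by
      filter_upwards [hAae] with ω hω using hYZ ω hω
    have hev : Measurable fun z : Ω' × I T => Y z.1 z.2 :=
      (ContinuousEval.continuous_eval (F := Paths T d)).measurable.comp
        ((hYm.comp measurable_fst).prodMk measurable_snd)
    rw [Measure.ae_ae_comm (p := fun ω t => Z (t, ω) = Y ω t) (measurableSet_eq_fun (by fun_prop) hev)] at h1
    filter_upwards [h1, hZX] with t h2 h3
    filter_upwards [h2, h3] with ω h4 h5
    rw [← h4, h5]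
  refine ⟨Y, hYm, fun t => ?_⟩
  have := leb_isOpenPosMeasure hT
  -- From almost every time to every time: approach `t` along good times, then use path continuity
  -- of `Y`, Fatou and the `L^p` continuity of `X`.
  obtain ⟨s, hs, hst⟩ := mem_closure_iff_seq_limit.1 (Measure.dense_of_ae hYX t)
  have hYmt : ∀ t, Measurable fun ω => Y ω t := fun t =>
    (ContinuousEvalConst.continuous_eval_const t).measurable.comp hYm
  have hzero : ∫⁻ ω, edist (Y ω t) (X t ω) ^ p ∂Q ≤ 0 := by
    calc ∫⁻ ω, edist (Y ω t) (X t ω) ^ p ∂Q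
        = ∫⁻ ω, liminf (fun n => edist (Y ω (s n)) (X t ω) ^ p) atTop ∂Q := by
          refine lintegral_congr fun ω => (Tendsto.liminf_eq ?_).symm
          exact ((ENNReal.continuous_rpow_const.comp
            ((Y ω).continuous.edist continuous_const)).tendsto t).comp hst
      _ ≤ liminf (fun n => ∫⁻ ω, edist (Y ω (s n)) (X t ω) ^ p ∂Q) atTop :=
          lintegral_liminf_le fun n => ((hYmt _).edist (hX t)).pow_const p
      _ = 0 := by
          refine Tendsto.liminf_eq (((hcont t).comp hst).congr fun n => ?_)
          refine lintegral_congr_ae ?_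
          filter_upwards [hs n] with ω hω
          rw [hω]
  have hae := (lintegral_eq_zero_iff (((hYmt t).edist (hX t)).pow_const p)).1
    (le_antisymm hzero zero_le)
  filter_upwards [hae] with ω hω
  exact edist_eq_zero.1 ((ENNReal.rpow_eq_zero_iff_of_pos hp0).1 hω)

end Modification

/-! ### Marginals of measures on paths -/

section PathMeasures

variable {d : ℕ} {T α p : ℝ}

theorem measurable_eval_paths : Measurable fun z : I T × Paths T d => z.2 z.1 :=
  (ContinuousEval.continuous_eval (F := Paths T d)).measurable.comp
    (measurable_snd.prodMk measurable_fst)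

theorem measurable_eval_const_paths (t : I T) : Measurable fun g : Paths T d => g t :=
  (ContinuousEvalConst.continuous_eval_const t).measurable

theorem measurable_pathEnergy (α p : ℝ) : Measurable (pathEnergy α p : Paths T d → ℝ≥0∞) :=
  measurable_sobolevEnergy measurable_eval_paths α p

/-- The Wasserstein distance between two marginals of a measure on paths. -/
theorem Wp_map_eval_rpow_le (hp : 0 < p) (m : Measure (Paths T d)) (s t : I T) :
    Wp p (m.map fun g => g s) (m.map fun g => g t) ^ p ≤ ∫⁻ g, edist (g s) (g t) ^ p ∂m := by
  have hs := measurable_eval_const_paths (d := d) s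
  have ht := measurable_eval_const_paths (d := d) t
  rw [Wp, ← ENNReal.rpow_mul, one_div_mul_cancel hp.ne', ENNReal.rpow_one]
  refine (iInf₂_le (m.map fun g => (g s, g t)) ⟨?_, ?_⟩).trans_eq ?_
  · rw [cost, lintegral_map (measurable_edist_rpow p) (by fun_prop)]
  · rw [Measure.map_map measurable_fst (by fun_prop)]; rfl
  · rw [Measure.map_map measurable_snd (by fun_prop)]; rfl

/-- The marginals of a measure on paths of finite expected energy form a Sobolev curve in the
Wasserstein space. -/
theorem marginals_memPp_and_isSobolevCurve (hT : 0 ≤ T) (hp : 1 < p) (hαp : 1 < α * p)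
    (m : Measure (Paths T d)) [IsProbabilityMeasure m]
    (hE : ∫⁻ g, pathEnergy α p g ∂m < ∞) {t₀ : I T} (h₀ : ∫⁻ g, ‖g t₀‖ₑ ^ p ∂m < ∞) :
    (∀ t : I T, MemPp p (m.map fun g => g t)) ∧
      IsSobolevCurve α p (fun s t : I T => Wp p (m.map fun g => g s) (m.map fun g => g t)) := by
  have hp0 : 0 < p := by linarith
  obtain ⟨C, hC, hhold⟩ := exists_edist_rpow_le_pathEnergy (d := d) hT hp hαp
  have hev := fun t : I T => measurable_eval_const_paths (d := d) t
  -- The pathwise Hölder bound, integrated; it yields both the moments at all times from those at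
  -- `t₀` and the continuity in Wasserstein distance.
  have htwo : ∀ s t : I T, ∫⁻ g, edist (g s) (g t) ^ p ∂m ≤
      C * ENNReal.ofReal (dist s t ^ (α * p - 1)) * ∫⁻ g, pathEnergy α p g ∂m := by
    intro s t
    rw [← lintegral_const_mul _ (measurable_pathEnergy α p)]
    refine lintegral_mono_ae ?_
    filter_upwards [ae_lt_top (measurable_pathEnergy α p) hE.ne] with g hg using hhold g hg s t
  refine ⟨fun t => ⟨Measure.isProbabilityMeasure_map (hev t).aemeasurable, ?_⟩, fun t => ?_, ?_⟩
  · rw [lintegral_map (by fun_prop) (hev t)]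
    have hle : ∀ g : Paths T d,
        ‖g t‖ₑ ^ p ≤ 2 ^ (p - 1) * (‖g t₀‖ₑ ^ p + edist (g t) (g t₀) ^ p) := by
      intro g
      refine le_trans ?_ (ENNReal.rpow_add_le_mul_rpow_add_rpow _ _ hp.le)
      refine ENNReal.rpow_le_rpow ?_ hp0.le
      rw [edist_eq_enorm_sub]
      calc ‖g t‖ₑ = ‖g t₀ + (g t - g t₀)‖ₑ := by rw [add_sub_cancel]
        _ ≤ _ := enorm_add_le _ _
    refine (lintegral_mono hle).trans_lt ?_
    have h1 := hev t
    have h2 := hev t₀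
    rw [lintegral_const_mul _ (by fun_prop), lintegral_add_left (h2.enorm.pow_const p)]
    refine ENNReal.mul_lt_top (ENNReal.rpow_lt_top_of_nonneg (by linarith) (by simp))
      (ENNReal.add_lt_top.2 ⟨h₀, (htwo t t₀).trans_lt ?_⟩)
    exact ENNReal.mul_lt_top (ENNReal.mul_lt_top hC.lt_top ENNReal.ofReal_lt_top) hE
  · have hγ0 : 0 < α * p - 1 := by linarith
    refine tendsto_edist_of_tendsto_rpow hp0 ?_
    refine tendsto_of_tendsto_of_tendsto_of_le_of_le tendsto_const_nhds ?_ (fun _ => zero_le)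
      fun s => (Wp_map_eval_rpow_le hp0 m s t).trans (htwo s t)
    have h2 : Tendsto (fun s : I T => ENNReal.ofReal (dist s t ^ (α * p - 1))) (𝓝 t) (𝓝 0) := by
      have h3 : Continuous fun s : I T => ENNReal.ofReal (dist s t ^ (α * p - 1)) :=
        ENNReal.continuous_ofReal.comp
          ((continuous_id.dist continuous_const).rpow_const fun _ => Or.inr hγ0.le)
      simpa [Real.zero_rpow hγ0.ne'] using h3.tendsto t
    have h4 := ENNReal.Tendsto.mul_const (ENNReal.Tendsto.const_mul h2 (a := C) (Or.inr hC))
      (b := ∫⁻ g, pathEnergy α p g ∂m) (Or.inr hE.ne)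
    rwa [mul_zero, zero_mul] at h4
  · refine lt_of_le_of_lt ?_ hE
    unfold pathEnergy
    rw [lintegral_sobolevEnergy_eq m measurable_eval_paths]
    refine lintegral_mono fun u => lintegral_mono fun v => ?_
    exact ENNReal.div_le_div_right (Wp_map_eval_rpow_le hp0 m u v) _

end PathMeasures

/-! ### Random push-forwards and the distances on random measures -/

section Lift

variable {d : ℕ} {T α p : ℝ} {Ω : Type*} [MeasurableSpace Ω]

/-- The random measure obtained by pushing `ν` forward along a random map. -/
noncomputable def pushKernel {F : Type*} [MeasurableSpace F] (ν : Measure (E d))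
    (Y : Ω × E d → F) : Kernel Ω F :=
  (Kernel.id ×ₖ Kernel.const Ω ν).map Y

theorem pushKernel_apply {F : Type*} [MeasurableSpace F] {ν : Measure (E d)} [SFinite ν]
    {Y : Ω × E d → F} (hY : Measurable Y) (ω : Ω) :
    pushKernel ν Y ω = ν.map fun y => Y (ω, y) := by
  rw [pushKernel, Kernel.map_apply _ hY, Kernel.prod_apply, Kernel.id_apply, Kernel.const_apply,
    Measure.dirac_prod, Measure.map_map hY (by fun_prop)]
  rfl

theorem lintegral_pushKernel {F : Type*} [MeasurableSpace F] {ν : Measure (E d)} [SFinite ν]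
    {Y : Ω × E d → F} (hY : Measurable Y) (ω : Ω) {h : F → ℝ≥0∞} (hh : Measurable h) :
    ∫⁻ x, h x ∂(pushKernel ν Y ω) = ∫⁻ y, h (Y (ω, y)) ∂ν := by
  rw [pushKernel_apply hY, lintegral_map hh (by fun_prop)]

theorem WWpBased_rpow (hp : 0 < p) (P : Measure Ω) (ν : Measure (E d)) (μ₀ μ₁ : Kernel Ω (E d)) :
    WWpBased p P ν μ₀ μ₁ ^ p = ∫⁻ ω, ∫⁻ y, edist (optMap p ν (μ₁ ω) y)
      (optMap p ν (μ₀ ω) y) ^ p ∂ν ∂P := by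
  rw [WWpBased, ← ENNReal.rpow_mul, one_div_mul_cancel hp.ne', ENNReal.rpow_one]
  refine lintegral_congr fun ω => ?_
  rw [WpBased, ← ENNReal.rpow_mul, one_div_mul_cancel hp.ne', ENNReal.rpow_one]

/-- The distance between two random measures is controlled by any random measure on paths having
them as marginals. -/
theorem WWp_rpow_le (hp : 0 < p) {P : Measure Ω} {μ₀ μ₁ : Kernel Ω (E d)}
    {π : Kernel Ω (Paths T d)} {s t : I T} (hs : ∀ᵐ ω ∂P, (π ω).map (fun g => g s) = μ₀ ω)
    (ht : ∀ᵐ ω ∂P, (π ω).map (fun g => g t) = μ₁ ω) :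
    WWp p P μ₀ μ₁ ^ p ≤ ∫⁻ ω, ∫⁻ g, edist (g t) (g s) ^ p ∂(π ω) ∂P := by
  have hes := measurable_eval_const_paths (d := d) s
  have het := measurable_eval_const_paths (d := d) t
  have hm : Measurable fun g : Paths T d => (g s, g t) := by fun_prop
  rw [WWp, ← ENNReal.rpow_mul, one_div_mul_cancel hp.ne', ENNReal.rpow_one]
  refine (iInf₂_le (π.map fun g => (g s, g t)) ?_).trans_eq ?_
  · filter_upwards [hs, ht] with ω h1 h2
    rw [Kernel.map_apply _ hm]
    constructor
    · rw [Measure.map_map measurable_fst hm, ← h1]; rfl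
    · rw [Measure.map_map measurable_snd hm, ← h2]; rfl
  · refine lintegral_congr fun ω => ?_
    rw [Kernel.map_apply _ hm, cost, lintegral_map (measurable_edist_rpow p) hm]
    simp only [edist_comm]

end Lift

end RandomLift

/-! ### Construction of the random lift -/

open RandomLift
theorem corollary4p3 {d : ℕ} {T : ℝ} (hT : 0 ≤ T) {α p : ℝ} (hp : 1 < p)
    (hαp : 1 / p < α) (hα : α < 1)
    {Ω : Type*} [MeasurableSpace Ω] (P : Measure Ω) [IsProbabilityMeasure P]
    -- the reference measure: absolutely continuous, with finite `p`-th moment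
    (ν : Measure (E d)) (hν : MemPp p ν) (hνac : ν ≪ volume)
    -- the measure-valued process, a `W^{α,p}` curve for the `ν`-based metric
    (μ : I T → Kernel Ω (E d)) (hμ : ∀ t, MemPpΩ p P (μ t))
    (hμW : IsSobolevCurve α p (fun s t => WWpBased p P ν (μ s) (μ t))) :
    -- existence and uniqueness of the optimal map from `ν` to `μ_t^ω`
    (∀ t, ∀ᵐ ω ∂P, IsOptimalMap p ν (μ t ω) (optMap p ν (μ t ω)) ∧
      ∀ S, IsOptimalMap p ν (μ t ω) S → S =ᵐ[ν] optMap p ν (μ t ω)) ∧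
    ∃ π : Kernel Ω (Paths T d), IsRandomProb P π ∧
      -- finite-dimensional marginals
      (∀ (j : ℕ) (t : Fin j → I T), ∀ᵐ ω ∂P,
        (π ω).map (fun γ i => γ (t i)) = ν.map (fun y i => optMap p ν (μ (t i) ω) y)) ∧
      -- concentration on `W^{α,p}` paths, and regularity of the marginal curves
      (∀ᵐ ω ∂P, (∀ᵐ γ ∂(π ω), pathEnergy α p γ < ∞) ∧
        (∀ t : I T, MemPp p ((π ω).map (fun γ => γ t))) ∧
        IsSobolevCurve α p (fun s t : I T =>
          Wp p ((π ω).map (fun γ => γ s)) ((π ω).map (fun γ => γ t)))) ∧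
      -- random lift
      (∀ t, ∀ᵐ ω ∂P, (π ω).map (fun γ => γ t) = μ t ω) ∧
      -- two-point estimates
      (∀ s t, WWp p P (μ s) (μ t) ^ p ≤ ∫⁻ ω, ∫⁻ γ, edist (γ t) (γ s) ^ p ∂(π ω) ∂P ∧
        ∫⁻ ω, ∫⁻ γ, edist (γ t) (γ s) ^ p ∂(π ω) ∂P = WWpBased p P ν (μ s) (μ t) ^ p) ∧
      -- energy
      sobolevEnergy α p (fun s t => WWp p P (μ s) (μ t)) ≤
        ∫⁻ ω, ∫⁻ γ, pathEnergy α p γ ∂(π ω) ∂P ∧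
      ∫⁻ ω, ∫⁻ γ, pathEnergy α p γ ∂(π ω) ∂P =
        sobolevEnergy α p (fun s t => WWpBased p P ν (μ s) (μ t)) := by
  have hp0 : 0 < p := by linarith
  have hαp' : 1 < α * p := by rwa [div_lt_iff₀ hp0] at hαp
  have := hν.1
  choose X hX hXae using fun t => exists_measurable_ae_eq_optMap hp hν hνac (μ t) (hμ t)
  refine ⟨fun t => (hXae t).mono fun ω h => ⟨h.1, h.2.1⟩, ?_⟩
  -- The central identity: the `ν`-based distance is the `L^p(P ⊗ ν)` distance between the optimal
  -- maps.
  have hD : ∀ s t, ∫⁻ z, edist (X s z) (X t z) ^ p ∂(P.prod ν)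
      = WWpBased p P ν (μ s) (μ t) ^ p := by
    intro s t
    rw [WWpBased_rpow hp0, lintegral_prod _ (((hX s).edist (hX t)).pow_const p).aemeasurable]
    refine lintegral_congr_ae ?_
    filter_upwards [hXae s, hXae t] with ω hs ht
    refine lintegral_congr_ae ?_
    filter_upwards [hs.2.2, ht.2.2] with y h1 h2
    rw [h1, h2, edist_comm]
  have hcont : ∀ t, Tendsto (fun s => ∫⁻ z, edist (X s z) (X t z) ^ p ∂(P.prod ν)) (𝓝 t)
      (𝓝 0) := by
    intro t
    simp only [hD]
    have h1 := (ENNReal.continuous_rpow_const (y := p)).tendsto 0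
    rw [ENNReal.zero_rpow_of_pos hp0] at h1
    exact h1.comp (hμW.1 t)
  have hE := hμW.2
  simp only [sobolevEnergy, ← hD] at hE
  obtain ⟨Y, hY, hYX⟩ := exists_continuous_modification hT hp hαp' hX hcont hE
  have hYopt : ∀ t, ∀ᵐ ω ∂P, (fun y => Y (ω, y) t) =ᵐ[ν] optMap p ν (μ t ω) := by
    intro t
    filter_upwards [Measure.ae_ae_of_ae_prod (hYX t), hXae t] with ω h1 h2
    filter_upwards [h1, h2.2.2] with y h3 h4
    rw [h3, h4]
  have hev := fun t : I T => measurable_eval_const_paths (d := d) t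
  have hprob : ∀ ω, IsProbabilityMeasure (pushKernel ν Y ω) := fun ω => by
    rw [pushKernel_apply hY]
    exact Measure.isProbabilityMeasure_map (by fun_prop)
  have hlift : ∀ t, ∀ᵐ ω ∂P, (pushKernel ν Y ω).map (fun γ => γ t) = μ t ω := by
    intro t
    filter_upwards [hYopt t, hXae t] with ω h1 h2
    have h3 := h2.1.2.1.2
    have hm : Measurable fun y => (y, optMap p ν (μ t ω) y) := measurable_id.prodMk h2.1.1
    rw [Measure.map_map measurable_snd hm] at h3
    rw [pushKernel_apply hY, Measure.map_map (hev t) (by fun_prop), ← h3]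
    exact Measure.map_congr h1
  have htwo : ∀ s t, ∫⁻ ω, ∫⁻ γ, edist (γ t) (γ s) ^ p ∂(pushKernel ν Y ω) ∂P
      = WWpBased p P ν (μ s) (μ t) ^ p := by
    intro s t
    rw [WWpBased_rpow hp0]
    refine lintegral_congr_ae ?_
    filter_upwards [hYopt s, hYopt t] with ω h1 h2
    rw [lintegral_pushKernel hY ω (((hev t).edist (hev s)).pow_const p)]
    refine lintegral_congr_ae ?_
    filter_upwards [h1, h2] with y h3 h4
    rw [h3, h4]
  have henergy : ∫⁻ ω, ∫⁻ γ, pathEnergy α p γ ∂(pushKernel ν Y ω) ∂P =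
      sobolevEnergy α p (fun s t => WWpBased p P ν (μ s) (μ t)) := by
    have hZ : Measurable fun z : I T × (Ω × E d) => Y z.2 z.1 :=
      measurable_eval_paths.comp (measurable_fst.prodMk (hY.comp measurable_snd))
    have h1 : ∫⁻ ω, ∫⁻ γ, pathEnergy α p γ ∂(pushKernel ν Y ω) ∂P
        = ∫⁻ z, pathEnergy α p (Y z) ∂(P.prod ν) := by
      rw [lintegral_prod (fun z => pathEnergy α p (Y z))
        ((measurable_pathEnergy α p).comp hY).aemeasurable]
      exact lintegral_congr fun ω => lintegral_pushKernel hY ω (measurable_pathEnergy α p)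
    rw [h1]
    refine (lintegral_sobolevEnergy_eq (P.prod ν) hZ).trans ?_
    refine lintegral_congr fun u => lintegral_congr fun v => ?_
    congr 1
    rw [← hD u v]
    refine lintegral_congr_ae ?_
    filter_upwards [hYX u, hYX v] with z h1 h2
    rw [h1, h2]
  have hfin : ∀ᵐ ω ∂P, ∫⁻ γ, pathEnergy α p γ ∂(pushKernel ν Y ω) < ∞ :=
    ae_lt_top ((Measure.measurable_lintegral (measurable_pathEnergy α p)).comp
      (pushKernel ν Y).measurable) (henergy ▸ hμW.2.ne)
  refine ⟨pushKernel ν Y, ae_of_all _ hprob, fun j t => ?_, ?_, hlift,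
    fun s t => ⟨WWp_rpow_le hp0 (hlift s) (hlift t), htwo s t⟩, ?_, henergy⟩
  · filter_upwards [ae_all_iff.2 fun i => hYopt (t i)] with ω hω
    rw [pushKernel_apply hY, Measure.map_map (measurable_pi_lambda _ fun i => hev (t i))
      (by fun_prop)]
    refine Measure.map_congr ?_
    filter_upwards [ae_all_iff.2 hω] with y hy
    exact funext hy
  -- One null set must serve all times, whereas `hlift` holds off a set depending on `t`. So only
  -- the moment at time 0 is taken from `μ`, and finite expected energy propagates it to all times.
  · let t₀ : I T := ⟨0, le_rfl, hT⟩
    have hmom : ∀ᵐ ω ∂P, ∫⁻ x, ‖x‖ₑ ^ p ∂(μ t₀ ω) < ∞ :=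
      ae_lt_top ((Measure.measurable_lintegral (by fun_prop)).comp (μ t₀).measurable)
        (hμ t₀).2.ne
    filter_upwards [hfin, hmom, hlift t₀] with ω h1 h2 h3
    have := hprob ω
    refine ⟨ae_lt_top (measurable_pathEnergy α p) h1.ne,
      marginals_memPp_and_isSobolevCurve hT hp hαp' _ h1 (t₀ := t₀) ?_⟩
    rwa [← h3, lintegral_map (by fun_prop) (hev t₀)] at h2
  · rw [henergy]
    refine lintegral_mono fun u => lintegral_mono fun v => ENNReal.div_le_div_right ?_ _
    exact (WWp_rpow_le hp0 (hlift u) (hlift v)).trans_eq (htwo u v)
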